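/- Let $p \ge 1$ be odd, let $m \ge 1$ be a multiple of $p$ with $m \neq p$, and put $q = m/p$. Let $H = G(m,p,2) \subset GL_2(\mathbb{C})$ be the group of all matrices $PD$, where $P$ is a permutation matrix and $D$ is a diagonal matrix whose entries are $m$-th roots of unity and which satisfies $\det(D)^{m/p}=1$. It acts on $S = \mathbb{C}[x,y]$ by linear substitutions; let $R = S^H$ be the invariant ring and let $\sigma_1 = (xy)^q$, $\sigma_2 = x^m+y^m$, $\Delta = \sigma_1(\sigma_2^2-4\sigma_1^p)$, which are elements of $R$. For every reflecting hyperplane $W$ of $H$ (a hyperplane of $\mathbb{C}^2$ fixed pointwise by some $g \neq 1$ in $H$) choose a linear form $\alpha_W \in S$ with kernel $W$, let $e_W$ be the order of the pointwise stabiliser of $W$ in $H$, and put $z = \prod_W \alpha_W$. For $0 \le j \le p$ let $$\phi_j= \begin{pmatrix} \sigma_2 & 2\sigma_1^j \\ 2\sigma_1^{p-j} & \sigma_2 \end{pmatrix},\quad \psi_j = \begin{pmatrix} \sigma_2\sigma_1 & -2\sigma_1^{j+1} \\ -2\sigma_1^{p+1-j} & \sigma_2\sigma_1 \end{pmatrix},\quad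 \xi_j=\begin{pmatrix}\sigma_2 & 2\sigma_1^j \\ 2\sigma_1^{p+1-j} & \sigma_2\sigma_1 \end{pmatrix},$$ and let $K_j$, $N_j$, $X_j$ be the cokernels of $\phi_j$, $\psi_j$, $\xi_j : R^2 \to R^2$, respectively. Then $\prod_W \alpha_W^{e_W}$ equals $\Delta$ up to a non-zero constant, $S/(z)$ and all the modules below are annihilated by $\Delta$, and as modules over $R/(\Delta)$ $$S/(z) \cong \bigoplus_{j=1}^{p}X_j^{2(q-1)} \oplus \bigoplus_{j=1}^{(p-1)/2} N_j^2 \oplus \bigoplus_{j=1}^{(p-1)/2}K_j^{2(q-1)^{2}} \oplus K_0^{2\binom{q-1}{2}} \oplus R/(\sigma_1)\oplus \bigl(R/(\sigma_2^2 - 4\sigma_1^p)\bigr)^{q-1} \oplus R/(\Delta)$$ $$\cong \bigoplus_{j=1}^{p}X_j^{2(q-1)} \oplus \bigoplus_{j=1}^{(p-1)/2} N_j^2 \oplus \bigoplus_{j=1}^{(p-1)/2}K_j^{2(q-1)^{2}} \oplus R/(\sigma_1)\oplus \bigl(R/(\sigma_2^2 - 4\sigma_1^p)\bigr)^{q-1+2\binom{q-1}{2}}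 \oplus R/(\Delta).$$ -/

import Mathlib

open scoped DirectSum

noncomputable section

namespace ReflGroup

/-- The group `G(m,p,n)`: all matrices `P D`, where `P` is a permutation matrix and `D` is a
diagonal matrix whose entries are `m`-th roots of unity and which satisfies
`det(D)^(m/p) = 1`. -/
def G (m p n : ℕ) : Subgroup (GL (Fin n) ℂ) where
  carrier := {g | ∃ (σ : Equiv.Perm (Fin n)) (d : Fin n → ℂ),
    (∀ i, d i ^ m = 1) ∧ (Matrix.diagonal d).det ^ (m / p) = 1 ∧
    (g : Matrix (Fin n) (Fin n) ℂ) = σ.permMatrix ℂ * Matrix.diagonal d}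
  one_mem' := ⟨1, 1, by simp, by simp, by simp⟩
  mul_mem' := by
    rintro g h ⟨σ, d, hd, hd', hg⟩ ⟨τ, e, he, he', hh⟩
    refine ⟨τ * σ, fun k => d (τ⁻¹ k) * e k, fun i => ?_, ?_, ?_⟩
    · rw [mul_pow, hd, he, one_mul]
    · rw [Matrix.det_diagonal] at *
      rw [Finset.prod_mul_distrib, Equiv.prod_comp τ⁻¹ d, mul_pow, hd', he', one_mul]
    · rw [Units.val_mul, hg, hh]
      ext i j
      simp only [Matrix.mul_apply, Equiv.Perm.permMatrix,
        PEquiv.toMatrix_apply, Equiv.toPEquiv_apply, Option.mem_some_iff, Equiv.Perm.mul_apply]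
      rw [Finset.sum_eq_single (σ i) (fun k _ hk => by simp [hk.symm]) (by simp)]
      by_cases hij : τ (σ i) = j
      · subst hij
        simp
      · simp [hij]
  inv_mem' := by
    rintro g ⟨σ, d, hd, hd', hg⟩
    have hd0 : (∀ i, d i ≠ 0) := by
      intro i h0
      have hu : IsUnit (g : Matrix (Fin n) (Fin n) ℂ).det :=
        (Matrix.isUnit_iff_isUnit_det _).mp g.isUnit
      rw [hg, Matrix.det_mul, Matrix.det_diagonal, Finset.prod_eq_zero (Finset.mem_univ i) h0,
        mul_zero] at hu
      exact not_isUnit_zero hu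
    refine ⟨σ⁻¹, fun i => (d (σ i))⁻¹, fun i => ?_, ?_, ?_⟩
    · rw [inv_pow, hd, inv_one]
    · rw [Matrix.det_diagonal] at *
      rw [Finset.prod_inv_distrib, Equiv.prod_comp σ d, inv_pow, hd', inv_one]
    · rw [Matrix.coe_units_inv, hg]
      apply Matrix.inv_eq_left_inv
      ext i j
      rw [Matrix.mul_apply, Finset.sum_eq_single (σ⁻¹ i)]
      · by_cases hij : i = j
        · subst hij
          simp [Matrix.mul_diagonal, Equiv.Perm.permMatrix, PEquiv.toMatrix_apply, hd0]
        · simp [Matrix.mul_diagonal, Equiv.Perm.permMatrix, PEquiv.toMatrix_apply, hij]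
      · intro k _ hk
        have hk' : ¬ Equiv.symm σ i = k := fun h => hk h.symm
        simp [Matrix.mul_diagonal, Equiv.Perm.permMatrix, PEquiv.toMatrix_apply, hk']
      · simp

/-- The linear substitution `x_i ↦ ∑_j g_{ij} x_j`: on polynomial functions on `ℂⁿ` it is
`f ↦ f ∘ g`. -/
def subst {n : ℕ} (g : GL (Fin n) ℂ) : MvPolynomial (Fin n) ℂ →ₐ[ℂ] MvPolynomial (Fin n) ℂ :=
  MvPolynomial.aeval fun i => ∑ j, MvPolynomial.C (g i j) * MvPolynomial.X j

/-- The invariant ring `S^G` of a matrix group `G` acting on `S = ℂ[x_1, …, x_n]`. -/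
def invariants {n : ℕ} (G : Subgroup (GL (Fin n) ℂ)) :
    Subalgebra ℂ (MvPolynomial (Fin n) ℂ) where
  carrier := {f | ∀ g ∈ G, subst g f = f}
  mul_mem' := fun ha hb g hg => by rw [map_mul, ha g hg, hb g hg]
  add_mem' := fun ha hb g hg => by rw [map_add, ha g hg, hb g hg]
  algebraMap_mem' := fun r g _ => (subst g).commutes r

/-- The reflecting hyperplanes of a finite matrix group `G`: the hyperplanes of `ℂⁿ` that are fixed
pointwise by some `g ≠ 1` in `G` (such a `g` has finite order, so it is diagonalisable). -/
def hyperplanes {n : ℕ} (G : Subgroup (GL (Fin n) ℂ)) : Set (Submodule ℂ (Fin n → ℂ)) :=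
  {W | Module.finrank ℂ W + 1 = n ∧
    ∃ g ∈ G, g ≠ 1 ∧ ∀ v ∈ W, (g : Matrix (Fin n) (Fin n) ℂ).mulVec v = v}

/-- `e_W`, the order of the pointwise stabiliser of `W` in `G`. -/
def fixerOrder {n : ℕ} (G : Subgroup (GL (Fin n) ℂ)) (W : Submodule ℂ (Fin n → ℂ)) : ℕ :=
  Nat.card {g : GL (Fin n) ℂ //
    g ∈ G ∧ ∀ v ∈ W, (g : Matrix (Fin n) (Fin n) ℂ).mulVec v = v}

/-- `ℓ` is a linear form with `W = ker ℓ`. -/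
def IsDefiningForm {n : ℕ} (W : Submodule ℂ (Fin n → ℂ)) (l : MvPolynomial (Fin n) ℂ) : Prop :=
  l.IsHomogeneous 1 ∧ ∀ v, v ∈ W ↔ MvPolynomial.eval v l = 0

/-- `z = ∏_W α_W`, the product over all reflecting hyperplanes `W` of `G`. -/
def arrangementPoly {n : ℕ} (G : Subgroup (GL (Fin n) ℂ))
    (α : Submodule ℂ (Fin n → ℂ) → MvPolynomial (Fin n) ℂ) : MvPolynomial (Fin n) ℂ :=
  ∏ᶠ W ∈ hyperplanes G, α W

/-- `δ = ∏_W α_W ^ e_W`, the discriminant of the group action. -/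
def discriminantPoly {n : ℕ} (G : Subgroup (GL (Fin n) ℂ))
    (α : Submodule ℂ (Fin n → ℂ) → MvPolynomial (Fin n) ℂ) : MvPolynomial (Fin n) ℂ :=
  ∏ᶠ W ∈ hyperplanes G, α W ^ fixerOrder G W

/-- `S = ℂ[x, y]`, with `x = X 0` and `y = X 1`. -/
abbrev S : Type := MvPolynomial (Fin 2) ℂ

/-- `R = S^H` for `H = G(m,p,2)`. -/
def R (m p : ℕ) : Type := invariants (G m p 2)

instance (m p : ℕ) : CommRing (R m p) := inferInstanceAs (CommRing (invariants (G m p 2)))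

instance (m p : ℕ) : Algebra ℂ (R m p) := inferInstanceAs (Algebra ℂ (invariants (G m p 2)))

/-- `S` is an algebra over `R` by the inclusion `R ⊆ S`. -/
instance (m p : ℕ) : Algebra (R m p) S := inferInstanceAs (Algebra (invariants (G m p 2)) S)

theorem subst_cases {m p : ℕ} {g : GL (Fin 2) ℂ} (hg : g ∈ G m p 2) :
    ∃ a b : ℂ, a ^ m = 1 ∧ b ^ m = 1 ∧ (a * b) ^ (m / p) = 1 ∧
      ((subst g (MvPolynomial.X 0) = MvPolynomial.C a * MvPolynomial.X 0 ∧
        subst g (MvPolynomial.X 1) = MvPolynomial.C b * MvPolynomial.X 1) ∨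
       (subst g (MvPolynomial.X 0) = MvPolynomial.C b * MvPolynomial.X 1 ∧
        subst g (MvPolynomial.X 1) = MvPolynomial.C a * MvPolynomial.X 0)) := by
  obtain ⟨σ, d, hd, hd', hg⟩ := hg
  refine ⟨d 0, d 1, hd 0, hd 1, by simpa using hd', ?_⟩
  have hσ : σ = 1 ∨ σ = Equiv.swap 0 1 := by
    clear hg
    revert σ
    decide
  rcases hσ with rfl | rfl
  · left
    simp [subst, hg]
  · right
    simp [subst, hg, Equiv.Perm.permMatrix, PEquiv.toMatrix_apply]

/-- `σ₁ = (xy)^q`, where `q = m/p`. -/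
def σ₁ (m p : ℕ) : R m p :=
  ⟨(MvPolynomial.X 0 * MvPolynomial.X 1) ^ (m / p), by
    intro g hg
    obtain ⟨a, b, -, -, hab, ⟨h0, h1⟩ | ⟨h0, h1⟩⟩ := subst_cases hg
    · rw [map_pow, map_mul, h0, h1, mul_mul_mul_comm, mul_pow, ← MvPolynomial.C_mul,
        ← MvPolynomial.C_pow, hab, MvPolynomial.C_1, one_mul]
    · rw [map_pow, map_mul, h0, h1, mul_mul_mul_comm, mul_pow, ← MvPolynomial.C_mul,
        ← MvPolynomial.C_pow, mul_comm b a, hab, MvPolynomial.C_1, one_mul,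
        mul_comm (MvPolynomial.X 1)]⟩

/-- `σ₂ = x^m + y^m`. -/
def σ₂ (m p : ℕ) : R m p :=
  ⟨MvPolynomial.X 0 ^ m + MvPolynomial.X 1 ^ m, by
    intro g hg
    obtain ⟨a, b, ha, hb, -, ⟨h0, h1⟩ | ⟨h0, h1⟩⟩ := subst_cases hg
    · rw [map_add, map_pow, map_pow, h0, h1, mul_pow, mul_pow, ← MvPolynomial.C_pow,
        ← MvPolynomial.C_pow, ha, hb, MvPolynomial.C_1, one_mul, one_mul]
    · rw [map_add, map_pow, map_pow, h0, h1, mul_pow, mul_pow, ← MvPolynomial.C_pow,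
        ← MvPolynomial.C_pow, ha, hb, MvPolynomial.C_1, one_mul, one_mul, add_comm]⟩

/-- The discriminant `Δ = σ₁(σ₂² - 4σ₁^p)`, an element of `R`. -/
def Δ (m p : ℕ) : R m p := σ₁ m p * (σ₂ m p ^ 2 - 4 * σ₁ m p ^ p)

/-- The cokernel of a matrix factorization `(φ, ψ)` is the cokernel of the map
`φ : Rⁿ → Rⁿ` on column vectors. -/
abbrev Coker {A : Type*} [CommRing A] {n : ℕ} (φ : Matrix (Fin n) (Fin n) A) : Type _ :=
  (Fin n → A) ⧸ LinearMap.range φ.mulVecLin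

/-- The first matrix of the matrix factorization `(φ_j, ψ_j)` of `Δ`, `0 ≤ j ≤ p`. -/
def φ (m p j : ℕ) : Matrix (Fin 2) (Fin 2) (R m p) :=
  !![σ₂ m p, 2 * σ₁ m p ^ j; 2 * σ₁ m p ^ (p - j), σ₂ m p]

/-- The second matrix of the matrix factorization `(φ_j, ψ_j)` of `Δ`, `0 ≤ j ≤ p`. -/
def ψ (m p j : ℕ) : Matrix (Fin 2) (Fin 2) (R m p) :=
  !![σ₂ m p * σ₁ m p, -2 * σ₁ m p ^ (j + 1); -2 * σ₁ m p ^ (p + 1 - j), σ₂ m p * σ₁ m p]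

/-- The first matrix of the matrix factorization `(ξ_j, η_j)` of `Δ`, `0 ≤ j ≤ p`. -/
def ξ (m p j : ℕ) : Matrix (Fin 2) (Fin 2) (R m p) :=
  !![σ₂ m p, 2 * σ₁ m p ^ j; 2 * σ₁ m p ^ (p + 1 - j), σ₂ m p * σ₁ m p]

/-- The second matrix of the matrix factorization `(ξ_j, η_j)` of `Δ`, `0 ≤ j ≤ p`. -/
def η (m p j : ℕ) : Matrix (Fin 2) (Fin 2) (R m p) :=
  !![σ₂ m p * σ₁ m p, -2 * σ₁ m p ^ j; -2 * σ₁ m p ^ (p + 1 - j), σ₂ m p]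

theorem φ_mul_ψ (m p j : ℕ) (hj : j ≤ p) : φ m p j * ψ m p j = Δ m p • 1 := by
  obtain ⟨k, rfl⟩ := Nat.exists_eq_add_of_le hj
  have h1 : j + k - j = k := by omega
  have h2 : j + k + 1 - j = k + 1 := by omega
  ext i l : 1
  fin_cases i <;> fin_cases l <;>
    simp [φ, ψ, Δ, h1, h2, Matrix.mul_apply, Fin.sum_univ_two] <;> ring

theorem ξ_mul_η (m p j : ℕ) (hj : j ≤ p) : ξ m p j * η m p j = Δ m p • 1 := by
  obtain ⟨k, rfl⟩ := Nat.exists_eq_add_of_le hj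
  have h2 : j + k + 1 - j = k + 1 := by omega
  ext i l : 1
  fin_cases i <;> fin_cases l <;>
    simp [ξ, η, Δ, h2, Matrix.mul_apply, Fin.sum_univ_two] <;> ring

/-- `X_j = Coker(ξ_j, η_j)`. -/
abbrev X (m p j : ℕ) : Type := Coker (ξ m p j)

/-- `K_j = Coker(φ_j, ψ_j)`. -/
abbrev K (m p j : ℕ) : Type := Coker (φ m p j)

/-- `N_j = Coker(ψ_j, φ_j)`. -/
abbrev N (m p j : ℕ) : Type := Coker (ψ m p j)

/-- The `A`-modules `M` and `M'` are annihilated by the ideal `I`, hence modules over `A/I`, and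
they are isomorphic as `A/I`-modules. -/
def IsoOverQuotient {A : Type*} [CommRing A] (I : Ideal A) (M M' : Type*)
    [AddCommGroup M] [Module A M] [AddCommGroup M'] [Module A M'] : Prop :=
  ∃ (h : Module.IsTorsionBySet A M I) (h' : Module.IsTorsionBySet A M' I),
    letI := h.module
    letI := h'.module
    Nonempty (M ≃ₗ[A ⧸ I] M')

end ReflGroup

end

namespace ReflGroup

open MvPolynomial (C coeff monomial)

/-! The reflecting lines are x = 0, y = 0 and x = ζy with ζ^m = 1, so z is xy(x^m - y^m) up to a
constant. Grade S by the characters of the diagonal subgroup of H, which form the group ℤ/q × ℤ/m.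
Invariants have weight 0, and each weight component of S is free of rank 2 over R, with a basis x^i
y^j x^{qe}, -x^i y^j y^{q(p-e)}: the two monomials have equal weight because qp = m. These pairs
together form a basis of S.

Since xy(x^m - y^m) is homogeneous for this grading, multiplication by it carries one component to
another and is therefore given by 2 × 2 blocks. They follow from x^m - y^m = σ₂ - 2y^m = -σ₂ + 2x^m
and (xy)^q = σ₁. Multiplication by xy contributes extra factors σ₁ only when an exponent i or j
wraps around modulo q. No wrap gives K_c, a single wrap gives some X_j, and a double wrap gives N_c.
Hence S/(z) is the direct sum of the block cokernels (`nonempty_quotient_equiv_pi_coker`,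
`nonempty_quotient_equiv_blocks`).

It remains to count. With n = q - 1 there are n² blocks K_c, 2n blocks X_j and one block N_c for
each index, where 0 ≤ c < p and 1 ≤ j ≤ p. Interchanging the basis vectors gives K_{p-j} ≅ K_j and
N_{p-j} ≅ N_j; as p is odd, only the index 0 is left unpaired. There an off-diagonal entry of φ_0,
or of ψ_0 divided by σ₁, is a unit, so K_0 ≅ R/(σ₂² - 4σ₁^p) and N_0 ≅ R/(σ₁) ⊕ R/(Δ). The two forms
of the answer differ by n² = n + 2·binom(n, 2). -/

/-- The variable `x` of `S = ℂ[x, y]`. -/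
noncomputable abbrev varX : S := MvPolynomial.X 0

/-- The variable `y` of `S = ℂ[x, y]`. -/
noncomputable abbrev varY : S := MvPolynomial.X 1

/-! ### Elements of G(m,p,2) and their action on coefficients. -/

theorem mem_G_two_iff {m p : ℕ} {g : GL (Fin 2) ℂ} :
    g ∈ G m p 2 ↔ ∃ a b : ℂ, a ^ m = 1 ∧ b ^ m = 1 ∧ (a * b) ^ (m / p) = 1 ∧
      ((g : Matrix (Fin 2) (Fin 2) ℂ) = !![a, 0; 0, b] ∨
       (g : Matrix (Fin 2) (Fin 2) ℂ) = !![0, b; a, 0]) := by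
  constructor
  · rintro ⟨σ, d, hd, hd', hg⟩
    refine ⟨d 0, d 1, hd 0, hd 1, by simpa using hd', ?_⟩
    have hσ : σ = 1 ∨ σ = Equiv.swap 0 1 := by
      clear hg
      revert σ
      decide
    rcases hσ with rfl | rfl
    · left
      ext i j
      fin_cases i <;> fin_cases j <;> simp [hg]
    · right
      ext i j
      fin_cases i <;> fin_cases j <;>
        simp [hg, Equiv.Perm.permMatrix, PEquiv.toMatrix_apply]
  · rintro ⟨a, b, ha, hb, hab, hg | hg⟩
    · refine ⟨1, ![a, b], ?_, ?_, ?_⟩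
      · intro i; fin_cases i <;> simp [ha, hb]
      · simpa using hab
      · ext i j
        fin_cases i <;> fin_cases j <;> simp [hg]
    · refine ⟨Equiv.swap 0 1, ![a, b], ?_, ?_, ?_⟩
      · intro i; fin_cases i <;> simp [ha, hb]
      · simpa using hab
      · ext i j
        fin_cases i <;> fin_cases j <;>
          simp [hg, Equiv.Perm.permMatrix, PEquiv.toMatrix_apply]

theorem exists_diag_mem_G {m p : ℕ} (hm : 0 < m) {a b : ℂ} (ha : a ^ m = 1) (hb : b ^ m = 1)
    (hab : (a * b) ^ (m / p) = 1) :
    ∃ g ∈ G m p 2, (g : Matrix (Fin 2) (Fin 2) ℂ) = !![a, 0; 0, b] := by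
  have ha0 : a ≠ 0 := by rintro rfl; simp [hm.ne'] at ha
  have hb0 : b ≠ 0 := by rintro rfl; simp [hm.ne'] at hb
  refine ⟨Matrix.GeneralLinearGroup.mkOfDetNeZero !![a, 0; 0, b] (by simp [ha0, hb0]), ?_, rfl⟩
  exact mem_G_two_iff.2 ⟨a, b, ha, hb, hab, Or.inl rfl⟩

theorem exists_antidiag_mem_G {m p : ℕ} (hm : 0 < m) {a b : ℂ} (ha : a ^ m = 1) (hb : b ^ m = 1)
    (hab : (a * b) ^ (m / p) = 1) :
    ∃ g ∈ G m p 2, (g : Matrix (Fin 2) (Fin 2) ℂ) = !![0, b; a, 0] := by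
  have ha0 : a ≠ 0 := by rintro rfl; simp [hm.ne'] at ha
  have hb0 : b ≠ 0 := by rintro rfl; simp [hm.ne'] at hb
  refine ⟨Matrix.GeneralLinearGroup.mkOfDetNeZero !![0, b; a, 0] (by simp [ha0, hb0]), ?_, rfl⟩
  exact mem_G_two_iff.2 ⟨a, b, ha, hb, hab, Or.inr rfl⟩

theorem coeff_subst_diag {g : GL (Fin 2) ℂ} {a b : ℂ}
    (hg : (g : Matrix (Fin 2) (Fin 2) ℂ) = !![a, 0; 0, b]) (f : S) (d : Fin 2 →₀ ℕ) :
    coeff d (subst g f) = a ^ d 0 * b ^ d 1 * coeff d f := by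
  induction f using MvPolynomial.induction_on' with
  | add f₁ f₂ h₁ h₂ => rw [map_add, MvPolynomial.coeff_add, h₁, h₂, MvPolynomial.coeff_add, mul_add]
  | monomial e c =>
    have : subst g (monomial e c) = monomial e (a ^ e 0 * b ^ e 1 * c) := by
      rw [subst, MvPolynomial.aeval_monomial, Finsupp.prod_fintype _ _ (by simp),
        MvPolynomial.monomial_eq (s := e) (a := a ^ e 0 * b ^ e 1 * c),
        Finsupp.prod_fintype _ _ (by simp)]
      simp [hg, mul_pow]
      ring
    rw [this, MvPolynomial.coeff_monomial, MvPolynomial.coeff_monomial]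
    split_ifs with h
    · rw [h]
    · simp

theorem subst_coe {m p : ℕ} {g : GL (Fin 2) ℂ} (hg : g ∈ G m p 2) (r : R m p) :
    subst g (algebraMap (R m p) S r) = algebraMap (R m p) S r :=
  r.2 g hg

theorem algebraMap_injective (m p : ℕ) : Function.Injective (algebraMap (R m p) S) :=
  Subtype.val_injective

theorem algebraMap_σ₁ {m p q : ℕ} (hp : 0 < p) (hq : m = p * q) :
    algebraMap (R m p) S (σ₁ m p) = (varX * varY) ^ q := by
  have : m / p = q := by rw [hq, Nat.mul_div_cancel_left _ hp]
  rw [← this]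
  rfl

theorem algebraMap_σ₂ (m p : ℕ) :
    algebraMap (R m p) S (σ₂ m p) = varX ^ m + varY ^ m := rfl

/-! ### The grading by characters of the diagonal subgroup. -/

/-- The weights of `x` and `y` in the character group `ℤ/q × ℤ/m` of the diagonal subgroup. -/
def weight (m q : ℕ) : Fin 2 → ZMod q × ZMod m := ![(1, 1), (0, -1)]

/-- With η and ω primitive roots of unity of orders q and m, invariance under diag(η, 1) forces q ∣
d 0 for each exponent d that occurs, and invariance under diag(ω, ω⁻¹) forces d 0 ≡ d 1 mod m. These
are the two coordinates of the weight. -/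
theorem isWeightedHomogeneous_coe {m p q : ℕ} (hm : 0 < m) (hp : 0 < p) (hq : m = p * q)
    (r : R m p) :
    MvPolynomial.IsWeightedHomogeneous (weight m q) (algebraMap (R m p) S r) 0 := by
  intro d hd
  have hq0 : q ≠ 0 := by rintro rfl; simp [hq] at hm
  have hdiv : m / p = q := by rw [hq, Nat.mul_div_cancel_left _ hp]
  have key : ∀ a b : ℂ, a ^ m = 1 → b ^ m = 1 → (a * b) ^ q = 1 → a ^ d 0 * b ^ d 1 = 1 := by
    intro a b ha hb hab
    obtain ⟨g, hg, hgm⟩ := exists_diag_mem_G (p := p) hm ha hb (by rwa [hdiv])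
    have h := coeff_subst_diag hgm (algebraMap (R m p) S r) d
    rw [subst_coe hg] at h
    exact mul_right_cancel₀ hd (by rw [one_mul]; exact h.symm)
  have h1 : q ∣ d 0 := by
    have hη := Complex.isPrimitiveRoot_exp q hq0
    rw [← hη.pow_eq_one_iff_dvd]
    have := key _ 1 (by rw [hq, mul_comm, pow_mul, hη.pow_eq_one, one_pow]) (one_pow _)
      (by rw [mul_one, hη.pow_eq_one])
    simpa using this
  have h2 : (d 0 : ZMod m) = d 1 := by
    have hω := Complex.isPrimitiveRoot_exp m hm.ne'
    set ω := Complex.exp (2 * Real.pi * Complex.I / m)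
    have hω0 : ω ≠ 0 := hω.ne_zero hm.ne'
    have := key ω ω⁻¹ hω.pow_eq_one (by rw [inv_pow, hω.pow_eq_one, inv_one])
      (by rw [mul_inv_cancel₀ hω0, one_pow])
    have hz : ω ^ ((d 0 : ℤ) - d 1) = 1 := by
      rw [zpow_sub₀ hω0, zpow_natCast, zpow_natCast, div_eq_mul_inv, ← inv_pow, this]
    have hz' := (ZMod.intCast_zmod_eq_zero_iff_dvd _ _).2 ((hω.zpow_eq_one_iff_dvd _).1 hz)
    push_cast at hz'
    exact sub_eq_zero.1 hz'
  rw [Finsupp.weight_apply, Finsupp.sum_fintype _ _ (by simp)]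
  ext <;> simp [weight, h2, (ZMod.natCast_eq_zero_iff _ _).2 h1]

/-! ### Freeness of S over R. -/

section Basis

variable {m p q : ℕ}

theorem σ₁_smul (hp : 0 < p) (hq : m = p * q) (f : S) :
    σ₁ m p • f = (varX * varY) ^ q * f := by
  rw [Algebra.smul_def, algebraMap_σ₁ hp hq]

theorem σ₂_smul (f : S) : σ₂ m p • f = (varX ^ m + varY ^ m) * f := by
  rw [Algebra.smul_def, algebraMap_σ₂]

/-- Induction on u + v. If both exponents are positive, split off σ₁. A pure power beyond the given
range is lowered by x^m = σ₂ - y^m or its mirror image; the mixed term this creates is again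
divisible by σ₁. -/
theorem mul_pow_mem_of_generators (hp : 0 < p) (hq : m = p * q) (P : Submodule (R m p) S) (w : S)
    (hx : ∀ c < p, w * varX ^ (q * c) ∈ P) (hy : ∀ c < p, w * varY ^ (q * (p - c)) ∈ P)
    (u v : ℕ) : w * (varX ^ (q * u) * varY ^ (q * v)) ∈ P := by
  induction h : u + v using Nat.strong_induction_on generalizing u v with
  | _ s ih =>
    subst h
    rcases Nat.eq_zero_or_pos v with rfl | hv
    · rcases lt_trichotomy u p with hu | rfl | hu
      · simpa using hx u hu
      · have h0 := P.smul_mem (σ₂ m u) (hx 0 hp)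
        have h1 := P.sub_mem h0 (hy 0 hp)
        rw [σ₂_smul] at h1
        convert h1 using 1
        simp only [hq, Nat.sub_zero, mul_comm q u]
        ring
      · obtain ⟨k, rfl⟩ := Nat.exists_eq_add_of_lt hu
        have h0 := P.smul_mem (σ₂ m p) (ih (k + 1) (by omega) (k + 1) 0 rfl)
        have h1 := P.smul_mem (σ₁ m p) (ih (k + (p - 1)) (by omega) k (p - 1) rfl)
        have h2 := P.sub_mem h0 h1
        rw [σ₂_smul, σ₁_smul hp hq] at h2
        convert h2 using 1
        obtain ⟨l, rfl⟩ : ∃ l, p = l + 1 := ⟨p - 1, by omega⟩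
        simp only [hq, Nat.add_sub_cancel]
        ring
    · rcases Nat.eq_zero_or_pos u with rfl | hu
      · rcases le_or_gt v p with hvp | hvp
        · have := hy (p - v) (by omega)
          rw [show p - (p - v) = v by omega] at this
          simpa using this
        · obtain ⟨k, rfl⟩ := Nat.exists_eq_add_of_lt hvp
          have h0 := P.smul_mem (σ₂ m p) (ih (0 + (k + 1)) (by omega) 0 (k + 1) rfl)
          have h1 := P.smul_mem (σ₁ m p) (ih ((p - 1) + k) (by omega) (p - 1) k rfl)
          have h2 := P.sub_mem h0 h1
          rw [σ₂_smul, σ₁_smul hp hq] at h2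
          convert h2 using 1
          obtain ⟨l, rfl⟩ : ∃ l, p = l + 1 := ⟨p - 1, by omega⟩
          simp only [hq, Nat.add_sub_cancel]
          ring
      · obtain ⟨u, rfl⟩ : ∃ l, u = l + 1 := ⟨u - 1, by omega⟩
        obtain ⟨v, rfl⟩ : ∃ l, v = l + 1 := ⟨v - 1, by omega⟩
        have h1 := P.smul_mem (σ₁ m p) (ih (u + v) (by omega) u v rfl)
        rw [σ₁_smul hp hq] at h1
        convert h1 using 1
        ring

/-- The shift δ leaves room for both families used later, the basis and the generating family of
sources. A shifted pair family still generates the unshifted one: it contains w = x^i y^j as its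
last y-term, and w y^m = σ₂ w - w x^m. -/
theorem eq_top_of_generators (hm : 0 < m) (hp : 0 < p) (hq : m = p * q) (P : Submodule (R m p) S)
    (δ : ℕ → ℕ → ℕ) (hδ : ∀ i j, δ i j ≤ 1)
    (hx : ∀ i < q, ∀ j < q, ∀ c < p, varX ^ i * varY ^ j * varX ^ (q * (c + δ i j)) ∈ P)
    (hy : ∀ i < q, ∀ j < q, ∀ c < p, varX ^ i * varY ^ j * varY ^ (q * (p - (c + δ i j))) ∈ P) :
    P = ⊤ := by
  have hq0 : 0 < q := Nat.pos_of_ne_zero (by rintro rfl; simp [hq] at hm)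
  have hgen : ∀ i < q, ∀ j < q, (∀ c < p, varX ^ i * varY ^ j * varX ^ (q * c) ∈ P) ∧
      ∀ c < p, varX ^ i * varY ^ j * varY ^ (q * (p - c)) ∈ P := by
    intro i hi j hj
    have hx := hx i hi j hj
    have hy := hy i hi j hj
    rcases Nat.le_one_iff_eq_zero_or_eq_one.1 (hδ i j) with h0 | h1
    · rw [h0] at hx hy
      exact ⟨hx, hy⟩
    · rw [h1] at hx hy
      have h1 : varX ^ i * varY ^ j ∈ P := by
        simpa [Nat.sub_add_cancel (Nat.one_le_of_lt hp)] using hy (p - 1) (by omega)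
      refine ⟨fun c hc => ?_, fun c hc => ?_⟩
      · cases c with
        | zero => simpa using h1
        | succ c => exact hx c (by omega)
      · cases c with
        | zero =>
          have h2 := P.sub_mem (P.smul_mem (σ₂ m p) h1) (hx (p - 1) (by omega))
          rw [Nat.sub_add_cancel (Nat.one_le_of_lt hp), mul_comm q, ← hq, σ₂_smul] at h2
          rw [Nat.sub_zero, mul_comm q, ← hq]
          convert h2 using 1
          ring
        | succ c => exact hy c (by omega)
  rw [eq_top_iff]
  rintro f -
  induction f using MvPolynomial.induction_on' with
  | add f₁ f₂ h₁ h₂ => exact P.add_mem h₁ h₂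
  | monomial e c =>
    have h := mul_pow_mem_of_generators hp hq P (varX ^ (e 0 % q) * varY ^ (e 1 % q))
      (hgen _ (Nat.mod_lt _ hq0) _ (Nat.mod_lt _ hq0)).1
      (hgen _ (Nat.mod_lt _ hq0) _ (Nat.mod_lt _ hq0)).2
      (e 0 / q) (e 1 / q)
    have h' := P.smul_mem (algebraMap ℂ (R m p) c) h
    have hc : algebraMap (R m p) S (algebraMap ℂ (R m p) c) = C c := rfl
    rw [Algebra.smul_def, hc] at h'
    convert h' using 1
    rw [MvPolynomial.monomial_eq, Finsupp.prod_fintype _ _ (by simp), Fin.prod_univ_two]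
    congr 1
    conv_lhs => rw [← Nat.mod_add_div (e 0) q, ← Nat.mod_add_div (e 1) q]
    ring

/-- The family `x^i y^j x^{q(c + δ)}`, `-x^i y^j y^{q(p - c - δ)}`, where `δ` depends on `i`
and `j`. -/
noncomputable def basisElt (p q : ℕ) (δ : ℕ → ℕ → ℕ) (t : (Fin q × Fin q × Fin p) × Fin 2) : S :=
  varX ^ (t.1.1 : ℕ) * varY ^ (t.1.2.1 : ℕ) *
    ![varX ^ (q * (t.1.2.2 + δ t.1.1 t.1.2.1)), -varY ^ (q * (p - (t.1.2.2 + δ t.1.1 t.1.2.1)))] t.2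

theorem span_basisElt (hm : 0 < m) (hp : 0 < p) (hq : m = p * q) {δ : ℕ → ℕ → ℕ}
    (hδ : ∀ i j, δ i j ≤ 1) :
    Submodule.span (R m p) (Set.range (basisElt p q δ)) = ⊤ := by
  refine eq_top_of_generators hm hp hq _ δ hδ (fun i hi j hj c hc => ?_) (fun i hi j hj c hc => ?_)
  · exact Submodule.subset_span ⟨((⟨i, hi⟩, ⟨j, hj⟩, ⟨c, hc⟩), 0), by simp [basisElt]⟩
  · rw [← Submodule.neg_mem_iff]
    exact Submodule.subset_span ⟨((⟨i, hi⟩, ⟨j, hj⟩, ⟨c, hc⟩), 1), by simp [basisElt]⟩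

/-- The weight of the two members of the family `basisElt` with index `t`. -/
def weightOf (m p q : ℕ) (δ : ℕ → ℕ → ℕ) (t : Fin q × Fin q × Fin p) : ZMod q × ZMod m :=
  ((t.1 : ℕ), (t.1 : ℕ) + (q * (t.2.2 + δ t.1 t.2.1) : ℕ) - (t.2.1 : ℕ))

theorem weightOf_injective (hq : m = p * q) (δ : ℕ → ℕ → ℕ) :
    Function.Injective (weightOf m p q δ) := by
  rintro ⟨i, j, c⟩ ⟨i', j', c'⟩ h
  simp only [weightOf, Prod.mk.injEq] at h
  obtain ⟨h1, h2⟩ := h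
  have hi : i = i' := by
    rw [ZMod.natCast_eq_natCast_iff] at h1
    exact Fin.ext (Nat.ModEq.eq_of_lt_of_lt h1 i.2 i'.2)
  subst hi
  -- Both subtracted exponents are moved across, so that the congruence can be read in ℕ: modulo q
  -- it determines j, then modulo m it determines c.
  have h3 : ((q * (c + δ i j) + j' : ℕ) : ZMod m) = ((q * (c' + δ i j') + j : ℕ) : ZMod m) := by
    push_cast at h2 ⊢
    linear_combination h2
  rw [ZMod.natCast_eq_natCast_iff] at h3
  have hjj : j = j' := by
    have := h3.of_dvd (Dvd.intro_left p hq.symm)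
    rw [Nat.ModEq, Nat.mul_add_mod, Nat.mul_add_mod, Nat.mod_eq_of_lt j.2,
      Nat.mod_eq_of_lt j'.2] at this
    exact Fin.ext this.symm
  subst hjj
  have h4 := Nat.ModEq.add_right_cancel' _ h3
  rw [mul_add, mul_add] at h4
  replace h4 := Nat.ModEq.add_right_cancel' _ h4
  have hq0 : 0 < q := i.pos
  have hlt : ∀ c : Fin p, q * c < m := fun c => by
    rw [hq, mul_comm p q]
    exact Nat.mul_lt_mul_of_pos_left c.2 hq0
  have h5 := Nat.ModEq.eq_of_lt_of_lt h4 (hlt c) (hlt c')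
  have : c = c' := Fin.ext (Nat.eq_of_mul_eq_mul_left hq0 h5)
  rw [this]

theorem isWeightedHomogeneous_basisElt (hq : m = p * q) {δ : ℕ → ℕ → ℕ} (hδ : ∀ i j, δ i j ≤ 1)
    (t : (Fin q × Fin q × Fin p) × Fin 2) :
    MvPolynomial.IsWeightedHomogeneous (weight m q) (basisElt p q δ t) (weightOf m p q δ t.1) := by
  obtain ⟨⟨i, j, c⟩, k⟩ := t
  set e := c + δ i j with he
  have hep : e ≤ p := by have := hδ i j; omega
  have hX := MvPolynomial.isWeightedHomogeneous_X ℂ (weight m q) 0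
  have hY := MvPolynomial.isWeightedHomogeneous_X ℂ (weight m q) 1
  have hc : (((q * (p - e) : ℕ) : ZMod m)) = - ((q * e : ℕ) : ZMod m) := by
    rw [eq_neg_iff_add_eq_zero, ← Nat.cast_add, ← mul_add, Nat.sub_add_cancel hep, mul_comm,
      ← hq, ZMod.natCast_self]
  have hx : weightOf m p q δ (i, j, c) =
      (i : ℕ) • weight m q 0 + (j : ℕ) • weight m q 1 + (q * e : ℕ) • weight m q 0 := by
    ext
    · simp [weightOf, weight]
    · simp only [weightOf, ← he, weight, Matrix.cons_val_zero, Matrix.cons_val_one, Prod.snd_add,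
        Prod.smul_snd]
      simp only [nsmul_eq_mul]
      ring
  have hy : weightOf m p q δ (i, j, c) =
      (i : ℕ) • weight m q 0 + (j : ℕ) • weight m q 1 + (q * (p - e) : ℕ) • weight m q 1 := by
    ext
    · simp [weightOf, weight]
    · simp only [weightOf, ← he, weight, Matrix.cons_val_zero, Matrix.cons_val_one, Prod.snd_add,
        Prod.smul_snd]
      simp only [nsmul_eq_mul, hc]
      ring
  fin_cases k
  · exact hx ▸ ((hX.pow i).mul (hY.pow j)).mul (hX.pow (q * e))
  · exact hy ▸ ((hX.pow i).mul (hY.pow j)).mul (hY.pow (q * (p - e))).neg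

theorem pow_sub_pow_ne_zero (hm : 0 < m) : (varX ^ m - varY ^ m : S) ≠ 0 := by
  intro h
  have := congrArg (MvPolynomial.eval ![1, 0]) h
  simp [hm.ne'] at this

/-- Interchanging x and y fixes r and s and so yields a second linear equation; the determinant of
the resulting system is x^m - y^m up to sign. -/
theorem eq_zero_of_pair (hm : 0 < m) (hq : m = p * q) {c : ℕ} (hc : c ≤ p)
    {r s : R m p}
    (h : algebraMap (R m p) S r * varX ^ (q * c) = algebraMap (R m p) S s * varY ^ (q * (p - c))) :
    r = 0 ∧ s = 0 := by
  obtain ⟨g, hg, hgm⟩ := exists_antidiag_mem_G (p := p) hm (one_pow m) (one_pow m)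
    (by rw [one_mul, one_pow])
  have h' := congrArg (subst g) h
  have hx : subst g varX = varY := by simp [subst, hgm]
  have hy : subst g varY = varX := by simp [subst, hgm]
  rw [map_mul, map_mul, subst_coe hg, subst_coe hg, map_pow, map_pow, hx, hy] at h'
  have hmc : q * c + q * (p - c) = m := by
    rw [← mul_add, Nat.add_sub_cancel' hc, hq, mul_comm]
  have hr : algebraMap (R m p) S r = 0 := by
    have : algebraMap (R m p) S r * (varX ^ m - varY ^ m) = 0 := by
      have hX : (varX ^ m : S) = varX ^ (q * c) * varX ^ (q * (p - c)) := by rw [← pow_add, hmc]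
      have hY : (varY ^ m : S) = varY ^ (q * c) * varY ^ (q * (p - c)) := by rw [← pow_add, hmc]
      rw [hX, hY]
      linear_combination varX ^ (q * (p - c)) * h - varY ^ (q * (p - c)) * h'
    exact (mul_eq_zero.1 this).resolve_right (pow_sub_pow_ne_zero hm)
  have hs : algebraMap (R m p) S s = 0 := by
    rw [hr, zero_mul] at h
    exact (mul_eq_zero.1 h.symm).resolve_right (pow_ne_zero _ (MvPolynomial.X_ne_zero _))
  exact ⟨algebraMap_injective m p (by rw [hr, map_zero]),
    algebraMap_injective m p (by rw [hs, map_zero])⟩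

/-- Coefficients from R do not change weights and distinct indices t have distinct weights, so a
relation splits into relations between the two members of each pair. -/
theorem linearIndependent_basisElt (hm : 0 < m) (hp : 0 < p) (hq : m = p * q) {δ : ℕ → ℕ → ℕ}
    (hδ : ∀ i j, δ i j ≤ 1) :
    LinearIndependent (R m p) (basisElt p q δ) := by
  classical
  rw [Fintype.linearIndependent_iff]
  intro r hr
  have hhom : ∀ t, MvPolynomial.IsWeightedHomogeneous (weight m q)
      (r t • basisElt p q δ t) (weightOf m p q δ t.1) := fun t => by
    rw [Algebra.smul_def]
    simpa using (isWeightedHomogeneous_coe hm hp hq (r t)).mul (isWeightedHomogeneous_basisElt hq hδ t)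
  have key : ∀ t, r (t, 0) = 0 ∧ r (t, 1) = 0 := by
    intro t
    have h := congrArg (MvPolynomial.weightedHomogeneousComponent (weight m q)
      (weightOf m p q δ t)) hr
    rw [map_sum, map_zero, Fintype.sum_prod_type, Finset.sum_eq_single t, Fin.sum_univ_two,
      (hhom (t, 0)).weightedHomogeneousComponent_same,
      (hhom (t, 1)).weightedHomogeneousComponent_same] at h
    · obtain ⟨i, j, c⟩ := t
      refine eq_zero_of_pair hm hq (c := c + δ i j) (by have := hδ i j; omega) ?_
      have hne : (varX ^ (i : ℕ) * varY ^ (j : ℕ) : S) ≠ 0 :=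
        mul_ne_zero (pow_ne_zero _ (MvPolynomial.X_ne_zero _))
          (pow_ne_zero _ (MvPolynomial.X_ne_zero _))
      apply mul_left_cancel₀ hne
      simp only [basisElt, Algebra.smul_def, Matrix.cons_val_zero, Matrix.cons_val_one] at h
      linear_combination h
    · intro t' _ ht'
      refine Finset.sum_eq_zero fun k _ => (hhom (t', k)).weightedHomogeneousComponent_ne _ ?_
      exact fun h => ht' (weightOf_injective hq δ h.symm)
    · simp
  rintro ⟨t, k⟩
  fin_cases k
  · exact (key t).1
  · exact (key t).2

/-- `S` is free over `R`. -/
noncomputable def basisS (hm : 0 < m) (hp : 0 < p) (hq : m = p * q) {δ : ℕ → ℕ → ℕ}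
    (hδ : ∀ i j, δ i j ≤ 1) :
    Module.Basis ((Fin q × Fin q × Fin p) × Fin 2) (R m p) S :=
  .mk (linearIndependent_basisElt hm hp hq hδ) (span_basisElt hm hp hq hδ).ge

end Basis

/-! ### Cokernels of equivalent and of block diagonal matrices. -/

section Cokernels

variable {A : Type*} [CommRing A]

/-- Equivalent matrices have isomorphic cokernels. -/
theorem nonempty_coker_equiv {n : ℕ} {M M' P Q : Matrix (Fin n) (Fin n) A} (hP : IsUnit P)
    (hQ : IsUnit Q) (h : P * M = M' * Q) : Nonempty (Coker M ≃ₗ[A] Coker M') := by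
  obtain ⟨P, rfl⟩ := hP
  obtain ⟨Q, rfl⟩ := hQ
  let e : (Fin n → A) ≃ₗ[A] (Fin n → A) :=
    LinearEquiv.ofLinearMap (P : Matrix _ _ A).mulVecLin (↑P⁻¹ : Matrix _ _ A).mulVecLin
      (by rw [← Matrix.mulVecLin_mul, Units.mul_inv, Matrix.mulVecLin_one])
      (by rw [← Matrix.mulVecLin_mul, Units.inv_mul, Matrix.mulVecLin_one])
  have he : (e : (Fin n → A) →ₗ[A] (Fin n → A)) = (P : Matrix _ _ A).mulVecLin := rfl
  refine ⟨Submodule.Quotient.equiv _ _ e ?_⟩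
  rw [he, ← LinearMap.range_comp, ← Matrix.mulVecLin_mul, h, Matrix.mulVecLin_mul,
    LinearMap.range_comp_of_range_eq_top]
  rw [LinearMap.range_eq_top]
  intro v
  exact ⟨(↑Q⁻¹ : Matrix _ _ A).mulVec v, by simp [Matrix.mulVec_mulVec]⟩

theorem nonempty_coker_equiv_of_swap {M M' : Matrix (Fin 2) (Fin 2) A} (h₀₀ : M 0 0 = M' 1 1)
    (h₀₁ : M 0 1 = M' 1 0) (h₁₀ : M 1 0 = M' 0 1) (h₁₁ : M 1 1 = M' 0 0) :
    Nonempty (Coker M ≃ₗ[A] Coker M') := by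
  have hu : IsUnit (!![0, 1; 1, 0] : Matrix (Fin 2) (Fin 2) A) := by
    rw [Matrix.isUnit_iff_isUnit_det]; simp
  refine nonempty_coker_equiv hu hu ?_
  ext i j
  fin_cases i <;> fin_cases j <;> simp [Matrix.mul_apply, Fin.sum_univ_two, *]

theorem nonempty_coker_equiv_of_swap_neg {M M' : Matrix (Fin 2) (Fin 2) A}
    (h₀₀ : M 0 0 = M' 1 1) (h₀₁ : M 0 1 = -M' 1 0) (h₁₀ : M 1 0 = -M' 0 1) (h₁₁ : M 1 1 = M' 0 0) :
    Nonempty (Coker M ≃ₗ[A] Coker M') := by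
  have hu : IsUnit (!![0, 1; -1, 0] : Matrix (Fin 2) (Fin 2) A) := by
    rw [Matrix.isUnit_iff_isUnit_det]; simp
  refine nonempty_coker_equiv hu hu ?_
  ext i j
  fin_cases i <;> fin_cases j <;> simp [Matrix.mul_apply, Fin.sum_univ_two, *]

/-- If `f` is a basis of the algebra `B` and the matrix of multiplication by `z` from a generating
family to `f` is block diagonal, then `B/(z)` is the direct sum of the cokernels of the blocks. -/
theorem nonempty_quotient_equiv_pi_coker {B ι : Type*} [CommRing B] [Algebra A B] [Fintype ι]
    {n : ℕ} (f : Module.Basis (ι × Fin n) A B) (e : ι × Fin n → B)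
    (he : Submodule.span A (Set.range e) = ⊤) (z : B) (M : ι → Matrix (Fin n) (Fin n) A)
    (h : ∀ t k, z * e (t, k) = ∑ l, M t l k • f (t, l)) :
    Nonempty ((B ⧸ Ideal.span {z}) ≃ₗ[A] ∀ t, Coker (M t)) := by
  classical
  let F : B ≃ₗ[A] (ι → Fin n → A) := f.equivFun ≪≫ₗ LinearEquiv.curry A A ι (Fin n)
  have hF : ∀ t k, F (z * e (t, k)) = Pi.single t ((M t).mulVec (Pi.single k 1)) := by
    intro t k
    ext t' l
    simp only [F, h, LinearEquiv.trans_apply, map_sum, map_smul, LinearEquiv.coe_curry,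
      Function.curry_apply, Module.Basis.equivFun_self, Finset.sum_apply, Pi.smul_apply]
    by_cases ht : t' = t
    · subst ht
      simp
    · simp [ht, Ne.symm ht]
  -- The ideal (z) is the image of multiplication by z, so the products of z with any generating
  -- family span it over A; independence of `e` plays no role.
  have hspan : (Ideal.span {z} : Submodule B B).restrictScalars A =
      Submodule.span A (Set.range fun s => z * e s) := by
    have : (Ideal.span {z} : Submodule B B).restrictScalars A =
        (⊤ : Submodule A B).map (LinearMap.mulLeft A z) := by
      ext b
      simp [Ideal.mem_span_singleton', mul_comm]
    rw [this, ← he, Submodule.map_span, ← Set.range_comp]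
    rfl
  have hmap : ((Ideal.span {z} : Submodule B B).restrictScalars A).map (F : B →ₗ[A] _) =
      Submodule.pi Set.univ fun t => LinearMap.range (M t).mulVecLin := by
    rw [hspan, Submodule.map_span, ← Set.range_comp]
    apply le_antisymm
    · rw [Submodule.span_le]
      rintro _ ⟨⟨t, k⟩, rfl⟩ t' -
      simp only [Function.comp, LinearEquiv.coe_coe, hF]
      by_cases ht : t' = t
      · subst ht
        simp only [Pi.single_eq_same]
        exact ⟨_, rfl⟩
      · simp [ht]
    · intro v hv
      choose w hw using fun t => hv t (Set.mem_univ t)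
      have hv' : v = ∑ t, ∑ k, w t k • F (z * e (t, k)) := by
        have hsum : ∀ t, ∑ k, w t k • F (z * e (t, k)) = Pi.single t (v t) := by
          intro t
          rw [← hw t]
          have hwt : w t = ∑ k, w t k • Pi.single k (1 : A) := by
            ext k
            simp [Finset.sum_apply, Pi.single_apply]
          conv_rhs => rw [hwt]
          simp only [hF, map_sum, map_smul, Matrix.mulVecLin_apply]
          ext t' l
          by_cases ht : t' = t
          · subst ht
            simp
          · simp [ht]
        simp only [hsum]
        exact (Finset.univ_sum_single v).symm
      rw [hv']
      exact Submodule.sum_mem _ fun t _ => Submodule.sum_mem _ fun k _ =>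
        Submodule.smul_mem _ _ (Submodule.subset_span ⟨(t, k), rfl⟩)
  exact ⟨(Submodule.Quotient.restrictScalarsEquiv A (Ideal.span {z} : Submodule B B)).symm ≪≫ₗ
    Submodule.Quotient.equiv _ _ F hmap ≪≫ₗ Submodule.quotientPi _⟩

theorem nonempty_coker_diagonal (a b : A) :
    Nonempty (Coker !![a, 0; 0, b] ≃ₗ[A] (A ⧸ Ideal.span {a}) × (A ⧸ Ideal.span {b})) := by
  have hr : LinearMap.range (!![a, 0; 0, b] : Matrix (Fin 2) (Fin 2) A).mulVecLin =
      Submodule.pi Set.univ ![Ideal.span {a}, Ideal.span {b}] := by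
    ext v
    simp only [LinearMap.mem_range, Submodule.mem_pi, Set.mem_univ, true_imp_iff,
      Fin.forall_fin_two, Matrix.cons_val_zero, Matrix.cons_val_one, Ideal.mem_span_singleton']
    constructor
    · rintro ⟨w, rfl⟩
      exact ⟨⟨w 0, by simp [mul_comm]; rfl⟩, ⟨w 1, by simp [mul_comm]; rfl⟩⟩
    · rintro ⟨⟨s, hs⟩, ⟨t, ht⟩⟩
      refine ⟨![s, t], ?_⟩
      ext i
      fin_cases i <;> simp [← hs, ← ht, mul_comm]
  exact ⟨Submodule.quotEquivOfEq _ _ hr ≪≫ₗ Submodule.quotientPi _ ≪≫ₗ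
    LinearEquiv.piFinTwo A _⟩

/-- The cokernel of `s • [a, u; v, a]` when `u` is invertible. -/
theorem nonempty_coker_equiv_of_isUnit {u : A} (hu : IsUnit u) (s a v : A)
    {M : Matrix (Fin 2) (Fin 2) A} (hM : M = !![s * a, s * u; s * v, s * a]) :
    Nonempty (Coker M ≃ₗ[A] (A ⧸ Ideal.span {s}) × (A ⧸ Ideal.span {s * (a ^ 2 - u * v)})) := by
  obtain ⟨f⟩ := nonempty_coker_diagonal s (s * (a ^ 2 - u * v))
  obtain ⟨g⟩ := nonempty_coker_equiv (M := M) (M' := !![s, 0; 0, s * (a ^ 2 - u * v)])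
    -- Row and column operations that clear the matrix with the unit u as pivot; both determinants
    -- are -u.
    (P := !![1, 0; a, -u]) (Q := !![a, u; 1, 0])
    (by rw [Matrix.isUnit_iff_isUnit_det]; simpa using hu)
    (by rw [Matrix.isUnit_iff_isUnit_det]; simpa using hu)
    (by
      subst hM
      ext i j
      fin_cases i <;> fin_cases j <;> simp [Matrix.mul_apply, Fin.sum_univ_two] <;> ring)
  exact ⟨g ≪≫ₗ f⟩

end Cokernels

/-! ### Multiplication by xy(x^m - y^m) in blocks. -/

section Blocks

variable {m p n : ℕ}

/-- The exponent `i - 1`, read modulo `n + 1`. -/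
def cyclicPred (n i : ℕ) : ℕ := if i = 0 then n else i - 1

/-- The blocks of the matrix of multiplication by `xy(x^m - y^m)`. -/
noncomputable def blockMatrix (m p n : ℕ) (t : Fin (n + 1) × Fin (n + 1) × Fin p) :
    Matrix (Fin 2) (Fin 2) (R m p) :=
  if t.1 = 0 then
    if t.2.1 = 0 then
      !![σ₂ m p * σ₁ m p, 2 * σ₁ m p ^ (p - t.2.2 + 1);
        2 * σ₁ m p ^ (t.2.2 + 1 : ℕ), σ₂ m p * σ₁ m p]
    else
      !![σ₂ m p, 2 * σ₁ m p ^ (p - t.2.2); 2 * σ₁ m p ^ (t.2.2 + 1 : ℕ), σ₂ m p * σ₁ m p]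
  else
    if t.2.1 = 0 then
      !![σ₂ m p * σ₁ m p, 2 * σ₁ m p ^ (p - t.2.2); 2 * σ₁ m p ^ (t.2.2 + 1 : ℕ), σ₂ m p]
    else
      !![σ₂ m p, 2 * σ₁ m p ^ (p - t.2.2); 2 * σ₁ m p ^ (t.2.2 : ℕ), σ₂ m p]

/-- The generating family on which multiplication by `xy(x^m - y^m)` is block diagonal. -/
noncomputable def sourceElt (p n : ℕ) (t : (Fin (n + 1) × Fin (n + 1) × Fin p) × Fin 2) : S :=
  varX ^ cyclicPred n t.1.1 * varY ^ cyclicPred n t.1.2.1 *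
    ![varX ^ ((n + 1) * (t.1.2.2 + if t.1.1 ≠ 0 ∧ t.1.2.1 = 0 then 1 else 0)),
      varY ^ ((n + 1) * (p - (t.1.2.2 + if t.1.1 ≠ 0 ∧ t.1.2.1 = 0 then 1 else 0)))] t.2

theorem span_sourceElt (hm : 0 < m) (hp : 0 < p) (hq : m = p * (n + 1)) :
    Submodule.span (R m p) (Set.range (sourceElt p n)) = ⊤ := by
  have hsucc : ∀ i < n + 1, ∃ i' : Fin (n + 1), cyclicPred n i' = i ∧ (i' = 0 ↔ i = n) := by
    intro i hi
    by_cases h : i = n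
    · exact ⟨0, by simp [cyclicPred, h], by simp [h]⟩
    · exact ⟨⟨i + 1, by omega⟩, by simp [cyclicPred], by simp [h, Fin.ext_iff]⟩
  -- The shift is written in terms of the actual exponents, where index 0 has become exponent n.
  refine eq_top_of_generators hm hp hq _ (fun i j => if i ≠ n ∧ j = n then 1 else 0)
    (fun i j => by split_ifs <;> simp)
    (fun i hi j hj c hc => ?_) (fun i hi j hj c hc => ?_)
  all_goals
    obtain ⟨i', hi', hi0⟩ := hsucc i hi
    obtain ⟨j', hj', hj0⟩ := hsucc j hj
  · exact Submodule.subset_span ⟨((i', j', ⟨c, hc⟩), 0), by simp [sourceElt, hi', hj', hi0, hj0]⟩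
  · exact Submodule.subset_span ⟨((i', j', ⟨c, hc⟩), 1), by simp [sourceElt, hi', hj', hi0, hj0]⟩

theorem nonempty_quotient_equiv_blocks (hm : 0 < m) (hp : 0 < p) (hq : m = p * (n + 1)) :
    Nonempty ((S ⧸ Ideal.span {varX * varY * (varX ^ m - varY ^ m)}) ≃ₗ[R m p]
      ∀ t, Coker (blockMatrix m p n t)) := by
  -- If only i wraps, x · x^n = x^q raises the power of x^q by one, so the target pair is shifted.
  -- If only j wraps, the source pair is shifted instead, so that y^q combines with the x-power to
  -- σ₁. The minus sign in `basisElt` makes the diagonal entries positive.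
  let δ : ℕ → ℕ → ℕ := fun i j => if i = 0 ∧ j ≠ 0 then 1 else 0
  have hδ : ∀ i j, δ i j ≤ 1 := fun i j => by dsimp only [δ]; split_ifs <;> simp
  refine nonempty_quotient_equiv_pi_coker (basisS hm hp hq hδ) (sourceElt p n)
    (span_sourceElt hm hp hq) _ _ ?_
  rintro ⟨i, j, ⟨c, hc⟩⟩ k
  obtain ⟨d, rfl⟩ : ∃ d, p = c + d + 1 := Nat.exists_eq_add_of_lt hc
  have e1 : c + d + 1 - c = d + 1 := by omega
  have e2 : c + d + 1 - (c + 1) = d := by omega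
  have h2 : algebraMap (R m (c + d + 1)) S 2 = 2 := map_ofNat _ 2
  rw [Fin.sum_univ_two]
  simp only [basisS, Module.Basis.mk_apply, Algebra.smul_def]
  rcases Fin.eq_zero_or_eq_succ i with rfl | ⟨i, rfl⟩ <;>
  rcases Fin.eq_zero_or_eq_succ j with rfl | ⟨j, rfl⟩ <;>
  fin_cases k <;>
  simp [blockMatrix, basisElt, sourceElt, cyclicPred, δ, e1, e2, h2, algebraMap_σ₁ hp hq,
    algebraMap_σ₂, Fin.succ_ne_zero] <;>
  subst hq <;> ring

end Blocks

/-! ### Reindexing of finite products. -/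

section Pi

variable {A : Type*} [CommRing A]

/-- Separation of the zero indices in a product over `Fin (n + 1) × Fin (n + 1) × ι`. -/
def piFinSuccFinSucc {n : ℕ} {ι : Type*} (M : Fin (n + 1) × Fin (n + 1) × ι → Type*)
    [∀ t, AddCommGroup (M t)] [∀ t, Module A (M t)] :
    (∀ t, M t) ≃ₗ[A] (∀ c, M (0, 0, c)) × (∀ (j : Fin n) c, M (0, j.succ, c)) ×
      (∀ (i : Fin n) c, M (i.succ, 0, c)) × (∀ (i j : Fin n) c, M (i.succ, j.succ, c)) where
  toFun f := (fun c => f (0, 0, c), fun j c => f (0, j.succ, c), fun i c => f (i.succ, 0, c),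
    fun i j c => f (i.succ, j.succ, c))
  invFun g t := Fin.cases (motive := fun i => ∀ j c, M (i, j, c))
    (Fin.cases g.1 g.2.1) (fun i => Fin.cases (g.2.2.1 i) (g.2.2.2 i)) t.1 t.2.1 t.2.2
  map_add' _ _ := rfl
  map_smul' _ _ := rfl
  left_inv f := by
    ext ⟨i, j, c⟩
    induction i using Fin.cases <;> induction j using Fin.cases <;> rfl
  right_inv _ := rfl

/-- Products may be interchanged. -/
def piSwap {ι κ : Type*} (M : κ → Type*) [∀ j, AddCommGroup (M j)] [∀ j, Module A (M j)] :
    (ι → ∀ j, M j) ≃ₗ[A] ∀ j, ι → M j where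
  toFun f j i := f i j
  invFun f i j := f j i
  map_add' _ _ := rfl
  map_smul' _ _ := rfl
  left_inv _ := rfl
  right_inv _ := rfl

/-- Functions into a product of modules. -/
def funProd {ι : Type*} (M N : Type*) [AddCommGroup M] [Module A M] [AddCommGroup N] [Module A N] :
    (ι → M × N) ≃ₗ[A] (ι → M) × (ι → N) where
  toFun f := (fun i => (f i).1, fun i => (f i).2)
  invFun f i := (f.1 i, f.2 i)
  map_add' _ _ := rfl
  map_smul' _ _ := rfl
  left_inv _ := rfl
  right_inv _ := rfl

/-- A power of a finite product as a direct sum of powers. -/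
noncomputable def powPiEquivDirectSum {ι κ : Type*} [Fintype ι] [Fintype κ] [DecidableEq κ]
    (M : κ → Type*) [∀ j, AddCommGroup (M j)] [∀ j, Module A (M j)] {a : ℕ}
    (ha : Fintype.card ι = a) : (ι → ∀ j, M j) ≃ₗ[A] ⨁ j, (Fin a → M j) :=
  LinearEquiv.funCongrLeft A _ (Fintype.equivFinOfCardEq ha).symm ≪≫ₗ piSwap M ≪≫ₗ
    (DirectSum.linearEquivFunOnFintype A κ fun j => Fin a → M j).symm

/-- Two equal powers of a finite product as a direct sum of powers. -/
noncomputable def powPiProdEquivDirectSum {ι κ : Type*} [Fintype ι] [Fintype κ] [DecidableEq κ]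
    (M : κ → Type*) [∀ j, AddCommGroup (M j)] [∀ j, Module A (M j)] {a : ℕ}
    (ha : Fintype.card ι = a) :
    ((ι → ∀ j, M j) × (ι → ∀ j, M j)) ≃ₗ[A] ⨁ j, (Fin (2 * a) → M j) :=
  (LinearEquiv.sumArrowLequivProdArrow ι ι A _).symm ≪≫ₗ
    powPiEquivDirectSum M (by rw [Fintype.card_sum, ha, two_mul])

variable (F : ℕ → Type*) [∀ j, AddCommGroup (F j)] [∀ j, Module A (F j)]

/-- Shift of the index by one. -/
def piFinEquivPiIcc (p : ℕ) : (∀ c : Fin p, F ((c : ℕ) + 1)) ≃ₗ[A] ∀ j : Finset.Icc 1 p, F j :=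
  LinearEquiv.piCongrLeft A (fun j : Finset.Icc 1 p => F j)
    { toFun := fun c : Fin p => ⟨c + 1, Finset.mem_Icc.2 (by omega)⟩
      invFun := fun j => ⟨j - 1, by have := Finset.mem_Icc.1 j.2; omega⟩
      left_inv := fun c => by simp
      right_inv := fun j => by
        have := Finset.mem_Icc.1 j.2
        ext
        simp only
        omega }

/-- Reversal of the index. -/
def piFinSubEquivPiIcc (p : ℕ) : (∀ c : Fin p, F (p - (c : ℕ))) ≃ₗ[A] ∀ j : Finset.Icc 1 p, F j :=
  LinearEquiv.piCongrLeft A (fun j : Finset.Icc 1 p => F j)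
    { toFun := fun c : Fin p => ⟨p - c, Finset.mem_Icc.2 (by omega)⟩
      invFun := fun j => ⟨p - j, by have := Finset.mem_Icc.1 j.2; omega⟩
      left_inv := fun c => by
        ext
        simp only
        omega
      right_inv := fun j => by
        have := Finset.mem_Icc.1 j.2
        ext
        simp only
        omega }

/-- The indices `0`, `j` and `p - j` with `1 ≤ j ≤ (p - 1)/2`, where `p` is odd. -/
noncomputable def optionSumIccEquivFin {p : ℕ} (hp : Odd p) :
    Option (Finset.Icc 1 ((p - 1) / 2) ⊕ Finset.Icc 1 ((p - 1) / 2)) ≃ Fin p :=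
  .ofBijective
    (fun t => t.elim ⟨0, hp.pos⟩ (Sum.elim
      (fun j => ⟨j, by have := Finset.mem_Icc.1 j.2; omega⟩)
      (fun j => ⟨p - j, by have := Finset.mem_Icc.1 j.2; omega⟩))) <| by
    obtain ⟨h, rfl⟩ := hp
    constructor
    · rintro (_ | ⟨j, hj⟩ | ⟨j, hj⟩) (_ | ⟨k, hk⟩ | ⟨k, hk⟩) hjk <;>
        (try have hj' := Finset.mem_Icc.1 hj) <;> (try have hk' := Finset.mem_Icc.1 hk) <;>
        simp only [Option.elim, Sum.elim_inl, Sum.elim_inr, Fin.mk.injEq,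
          Option.some.injEq, Sum.inl.injEq, Sum.inr.injEq, Subtype.mk.injEq, reduceCtorEq]
          at hjk ⊢ <;>
        omega
    · rintro ⟨c, hc⟩
      rcases Nat.eq_zero_or_pos c with rfl | hc0
      · exact ⟨none, rfl⟩
      · by_cases hch : c ≤ h
        · exact ⟨some (.inl ⟨c, Finset.mem_Icc.2 (by omega)⟩), rfl⟩
        · refine ⟨some (.inr ⟨2 * h + 1 - c, Finset.mem_Icc.2 (by omega)⟩), Fin.ext ?_⟩
          simp only [Option.elim, Sum.elim_inr]
          omega

/-- The involution j ↦ p - j on 1, …, p - 1 has no fixed point for odd p, so each j ≤ (p - 1)/2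
accounts for two factors and only index 0 stands alone. -/
theorem nonempty_pi_equiv_of_symm {p : ℕ} (hp : Odd p)
    (hF : ∀ j ≤ p, Nonempty (F (p - j) ≃ₗ[A] F j)) :
    Nonempty ((∀ c : Fin p, F c) ≃ₗ[A] F 0 × (∀ j : Finset.Icc 1 ((p - 1) / 2), F j) ×
      (∀ j : Finset.Icc 1 ((p - 1) / 2), F j)) := by
  have hF' : ∀ j : Finset.Icc 1 ((p - 1) / 2), Nonempty (F (p - j) ≃ₗ[A] F j) := fun j =>
    hF j (by have := Finset.mem_Icc.1 j.2; omega)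
  let f := LinearEquiv.piCongrLeft A (fun c : Fin p => F c) (optionSumIccEquivFin hp)
  let g := LinearEquiv.piOptionEquivProd A (M := fun t => F (optionSumIccEquivFin hp t))
  let k := LinearEquiv.sumPiEquivProdPi A _ _ fun t => F (optionSumIccEquivFin hp (some t))
  exact ⟨f.symm ≪≫ₗ g ≪≫ₗ (LinearEquiv.refl A (F 0)).prodCongr
    (k ≪≫ₗ (LinearEquiv.refl A _).prodCongr (LinearEquiv.piCongrRight fun j => (hF' j).some))⟩

end Pi

/-! ### Identification and counting of the blocks. -/

section Decomposition

variable {m p n : ℕ}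

theorem isUnit_two_R (m p : ℕ) : IsUnit (2 : R m p) := by
  have h : IsUnit (algebraMap ℂ (R m p) 2) := (IsUnit.mk0 (2 : ℂ) two_ne_zero).map _
  rwa [map_ofNat] at h

theorem nonempty_K_symm (m : ℕ) {j : ℕ} (hj : j ≤ p) :
    Nonempty (K m p (p - j) ≃ₗ[R m p] K m p j) :=
  nonempty_coker_equiv_of_swap (by simp [φ]) (by simp [φ]) (by simp [φ, Nat.sub_sub_self hj])
    (by simp [φ])

theorem nonempty_N_symm (m : ℕ) {j : ℕ} (hj : j ≤ p) :
    Nonempty (N m p (p - j) ≃ₗ[R m p] N m p j) :=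
  nonempty_coker_equiv_of_swap (by simp [ψ]) (by simp [ψ, Nat.sub_add_comm hj])
    (by simp [ψ, show p + 1 - (p - j) = j + 1 by omega]) (by simp [ψ])

theorem nonempty_K_zero_equiv (m p : ℕ) :
    Nonempty (K m p 0 ≃ₗ[R m p] R m p ⧸ Ideal.span {σ₂ m p ^ 2 - 4 * σ₁ m p ^ p}) := by
  obtain ⟨e⟩ := nonempty_coker_equiv_of_isUnit (isUnit_two_R m p) 1 (σ₂ m p) (2 * σ₁ m p ^ p)
    (M := φ m p 0) (by simp [φ])
  have h4 : 1 * (σ₂ m p ^ 2 - 2 * (2 * σ₁ m p ^ p)) = σ₂ m p ^ 2 - 4 * σ₁ m p ^ p := by ring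
  rw [h4] at e
  have : Subsingleton (R m p ⧸ Ideal.span {(1 : R m p)}) :=
    Ideal.Quotient.subsingleton_iff.2 Ideal.span_singleton_one
  have : Unique (R m p ⧸ Ideal.span {(1 : R m p)}) := ⟨⟨0⟩, fun _ => Subsingleton.elim _ _⟩
  exact ⟨e ≪≫ₗ LinearEquiv.uniqueProd⟩

theorem nonempty_N_zero_equiv (m p : ℕ) :
    Nonempty (N m p 0 ≃ₗ[R m p] (R m p ⧸ Ideal.span {σ₁ m p}) × (R m p ⧸ Ideal.span {Δ m p})) := by
  obtain ⟨e⟩ := nonempty_coker_equiv_of_isUnit (isUnit_two_R m p).neg (σ₁ m p) (σ₂ m p)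
    -- Here s = σ₁, and the unit entry is u = -2.
    (-2 * σ₁ m p ^ p) (M := ψ m p 0) (by simp [ψ]; ring_nf; simp)
  have h4 : σ₁ m p * (σ₂ m p ^ 2 - -2 * (-2 * σ₁ m p ^ p)) = Δ m p := by rw [Δ]; ring
  rw [h4] at e
  exact ⟨e⟩

/-- The off-diagonal signs of the block are opposite to those of ψ, hence the signed interchange of
basis vectors. -/
theorem nonempty_block_zero_zero (m n : ℕ) (c : Fin p) :
    Nonempty (Coker (blockMatrix m p n (0, 0, c)) ≃ₗ[R m p] N m p c) :=
  nonempty_coker_equiv_of_swap_neg (by simp [blockMatrix, ψ])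
    (by simp [blockMatrix, ψ, Nat.sub_add_comm c.2.le]) (by simp [blockMatrix, ψ])
    (by simp [blockMatrix, ψ])

theorem nonempty_block_zero_succ (m : ℕ) (j : Fin n) (c : Fin p) :
    Nonempty (Coker (blockMatrix m p n (0, j.succ, c)) ≃ₗ[R m p] X m p (p - c)) := by
  have h : blockMatrix m p n (0, j.succ, c) = ξ m p (p - c) := by
    simp [blockMatrix, ξ, Fin.succ_ne_zero, show p + 1 - (p - (c : ℕ)) = c + 1 by omega]
  rw [h]
  exact ⟨LinearEquiv.refl _ _⟩

/-- As c runs through 0, …, p - 1, both c + 1 here and p - c in the case where only i wraps run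
through 1, …, p, so each kind of single wrap contributes every X_j equally often. -/
theorem nonempty_block_succ_zero (m : ℕ) (i : Fin n) (c : Fin p) :
    Nonempty (Coker (blockMatrix m p n (i.succ, 0, c)) ≃ₗ[R m p] X m p (c + 1)) :=
  nonempty_coker_equiv_of_swap (by simp [blockMatrix, ξ, Fin.succ_ne_zero])
    (by simp [blockMatrix, ξ, Fin.succ_ne_zero]) (by simp [blockMatrix, ξ, Fin.succ_ne_zero])
    (by simp [blockMatrix, ξ, Fin.succ_ne_zero])

theorem nonempty_block_succ_succ (m : ℕ) (i j : Fin n) (c : Fin p) :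
    Nonempty (Coker (blockMatrix m p n (i.succ, j.succ, c)) ≃ₗ[R m p] K m p c) :=
  nonempty_coker_equiv_of_swap (by simp [blockMatrix, φ, Fin.succ_ne_zero])
    (by simp [blockMatrix, φ, Fin.succ_ne_zero]) (by simp [blockMatrix, φ, Fin.succ_ne_zero])
    (by simp [blockMatrix, φ, Fin.succ_ne_zero])

theorem nonempty_quotient_equiv_pi (hm : 0 < m) (hp : 0 < p) (hq : m = p * (n + 1)) :
    Nonempty ((S ⧸ Ideal.span {varX * varY * (varX ^ m - varY ^ m)}) ≃ₗ[R m p]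
      (∀ c : Fin p, N m p c) × (Fin n → ∀ c : Fin p, X m p (p - c)) ×
      (Fin n → ∀ c : Fin p, X m p ((c : ℕ) + 1)) × (Fin n → Fin n → ∀ c : Fin p, K m p c)) := by
  obtain ⟨e⟩ := nonempty_quotient_equiv_blocks hm hp hq
  exact ⟨e ≪≫ₗ piFinSuccFinSucc _ ≪≫ₗ
    (LinearEquiv.piCongrRight fun c => (nonempty_block_zero_zero m n c).some).prodCongr
      ((LinearEquiv.piCongrRight fun j => LinearEquiv.piCongrRight fun c =>
        (nonempty_block_zero_succ m j c).some).prodCongr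
      ((LinearEquiv.piCongrRight fun i => LinearEquiv.piCongrRight fun c =>
        (nonempty_block_succ_zero m i c).some).prodCongr
      (LinearEquiv.piCongrRight fun i => LinearEquiv.piCongrRight fun j =>
        LinearEquiv.piCongrRight fun c => (nonempty_block_succ_succ m i j c).some)))⟩

theorem nonempty_N_part (m : ℕ) (hp : Odd p) :
    Nonempty ((∀ c : Fin p, N m p c) ≃ₗ[R m p]
      ((R m p ⧸ Ideal.span {σ₁ m p}) × (R m p ⧸ Ideal.span {Δ m p})) ×
        ⨁ j : Finset.Icc 1 ((p - 1) / 2), (Fin 2 → N m p j)) := by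
  obtain ⟨e⟩ := nonempty_pi_equiv_of_symm (N m p) hp fun j hj => nonempty_N_symm m hj
  obtain ⟨f⟩ := nonempty_N_zero_equiv m p
  let u := (LinearEquiv.funUnique Unit (R m p) (∀ j : Finset.Icc 1 ((p - 1) / 2), N m p j)).symm
  exact ⟨e ≪≫ₗ f.prodCongr (u.prodCongr u ≪≫ₗ powPiProdEquivDirectSum _ (a := 1) (by simp))⟩

theorem nonempty_X_part (m p n : ℕ) :
    Nonempty (((Fin n → ∀ c : Fin p, X m p (p - c)) × (Fin n → ∀ c : Fin p, X m p ((c : ℕ) + 1)))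
      ≃ₗ[R m p] ⨁ j : Finset.Icc 1 p, (Fin (2 * n) → X m p j)) :=
  ⟨(LinearEquiv.piCongrRight fun _ => piFinSubEquivPiIcc (X m p) p).prodCongr
    (LinearEquiv.piCongrRight fun _ => piFinEquivPiIcc (X m p) p) ≪≫ₗ
    powPiProdEquivDirectSum _ (by simp)⟩

theorem sq_eq_add_choose_two (n : ℕ) : n ^ 2 = n + 2 * n.choose 2 := by
  rw [Nat.choose_two_right, Nat.mul_div_cancel' (Nat.even_mul_pred_self n).two_dvd]
  cases n with
  | zero => rfl
  | succ n => rw [Nat.add_sub_cancel]; ring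

set_option synthInstance.maxHeartbeats 200000 in
theorem nonempty_K_part (m n : ℕ) (hp : Odd p) :
    Nonempty ((Fin n → Fin n → ∀ c : Fin p, K m p c) ≃ₗ[R m p]
      (Fin (n + 2 * n.choose 2) → K m p 0) ×
        ⨁ j : Finset.Icc 1 ((p - 1) / 2), (Fin (2 * n ^ 2) → K m p j)) := by
  obtain ⟨e⟩ := nonempty_pi_equiv_of_symm (K m p) hp fun j hj => nonempty_K_symm m hj
  have hcard : Fintype.card (Fin n × Fin n) = n ^ 2 := by simp [sq]
  exact ⟨(LinearEquiv.curry (R m p) _ (Fin n) (Fin n)).symm ≪≫ₗ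
    LinearEquiv.piCongrRight (fun _ => e) ≪≫ₗ funProd _ _ ≪≫ₗ
    (LinearEquiv.funCongrLeft (R m p) _
      (Fintype.equivFinOfCardEq (hcard.trans (sq_eq_add_choose_two n))).symm).prodCongr
    (funProd _ _ ≪≫ₗ powPiProdEquivDirectSum _ hcard)⟩

/-- A permutation of the factors of a product. -/
def prodRearrange (A : Type*) [CommRing A] (M₁ M₂ M₃ M₄ M₅ M₆ : Type*)
    [AddCommMonoid M₁] [AddCommMonoid M₂] [AddCommMonoid M₃] [AddCommMonoid M₄] [AddCommMonoid M₅]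
    [AddCommMonoid M₆] [Module A M₁] [Module A M₂] [Module A M₃] [Module A M₄] [Module A M₅]
    [Module A M₆] :
    (((M₁ × M₂) × M₃) × M₄ × (M₅ × M₆)) ≃ₗ[A] M₄ × M₃ × M₆ × M₁ × M₅ × M₂ where
  toFun v := (v.2.1, v.1.2, v.2.2.2, v.1.1.1, v.2.2.1, v.1.1.2)
  invFun w := (((w.2.2.2.1, w.2.2.2.2.2), w.2.1), w.1, (w.2.2.2.2.1, w.2.2.1))
  map_add' _ _ := rfl
  map_smul' _ _ := rfl
  left_inv _ := rfl
  right_inv _ := rfl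

theorem nonempty_quotient_equiv_short (hm : 0 < m) (hp : Odd p) (hq : m = p * (n + 1)) :
    Nonempty ((S ⧸ Ideal.span {varX * varY * (varX ^ m - varY ^ m)}) ≃ₗ[R m p]
      (⨁ j : Finset.Icc 1 p, (Fin (2 * n) → X m p j)) ×
        (⨁ j : Finset.Icc 1 ((p - 1) / 2), (Fin 2 → N m p j)) ×
        (⨁ j : Finset.Icc 1 ((p - 1) / 2), (Fin (2 * n ^ 2) → K m p j)) ×
        (R m p ⧸ Ideal.span {σ₁ m p}) ×
        (Fin (n + 2 * n.choose 2) → R m p ⧸ Ideal.span {σ₂ m p ^ 2 - 4 * σ₁ m p ^ p}) ×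
        (R m p ⧸ Ideal.span {Δ m p})) := by
  obtain ⟨e⟩ := nonempty_quotient_equiv_pi hm hp.pos hq
  obtain ⟨eN⟩ := nonempty_N_part m hp
  obtain ⟨eX⟩ := nonempty_X_part m p n
  obtain ⟨eK⟩ := nonempty_K_part m n hp
  obtain ⟨e₀⟩ := nonempty_K_zero_equiv m p
  exact ⟨e ≪≫ₗ eN.prodCongr ((LinearEquiv.prodAssoc _ _ _ _).symm ≪≫ₗ eX.prodCongr (eK ≪≫ₗ
    (LinearEquiv.piCongrRight fun _ => e₀).prodCongr (LinearEquiv.refl _ _))) ≪≫ₗ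
    prodRearrange _ _ _ _ _ _ _⟩

/-- Insertion of copies of `K₀`, which is isomorphic to `R/(σ₂² - 4σ₁^p)`. -/
theorem nonempty_split_K_zero (m p n k : ℕ) (M₁ M₂ M₃ M₄ M₅ : Type*)
    [AddCommMonoid M₁] [AddCommMonoid M₂] [AddCommMonoid M₃] [AddCommMonoid M₄] [AddCommMonoid M₅]
    [Module (R m p) M₁] [Module (R m p) M₂] [Module (R m p) M₃] [Module (R m p) M₄]
    [Module (R m p) M₅] :
    Nonempty ((M₁ × M₂ × M₃ × M₄ ×
        (Fin (n + k) → R m p ⧸ Ideal.span {σ₂ m p ^ 2 - 4 * σ₁ m p ^ p}) × M₅) ≃ₗ[R m p]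
      M₁ × M₂ × M₃ × (Fin k → K m p 0) × M₄ ×
        (Fin n → R m p ⧸ Ideal.span {σ₂ m p ^ 2 - 4 * σ₁ m p ^ p}) × M₅) := by
  obtain ⟨e₀⟩ := nonempty_K_zero_equiv m p
  let Q := R m p ⧸ Ideal.span {σ₂ m p ^ 2 - 4 * σ₁ m p ^ p}
  let s : (Fin (n + k) → Q) ≃ₗ[R m p] (Fin n → Q) × (Fin k → K m p 0) :=
    LinearEquiv.funCongrLeft (R m p) Q finSumFinEquiv ≪≫ₗ
      LinearEquiv.sumArrowLequivProdArrow _ _ _ _ ≪≫ₗ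
      (LinearEquiv.refl _ _).prodCongr (LinearEquiv.piCongrRight fun _ => e₀.symm)
  refine ⟨(LinearEquiv.refl _ _).prodCongr ((LinearEquiv.refl _ _).prodCongr
    ((LinearEquiv.refl _ _).prodCongr ((LinearEquiv.refl _ _).prodCongr
      (s.prodCongr (LinearEquiv.refl _ _)) ≪≫ₗ ?_)))⟩
  exact
    { toFun := fun v => (v.2.1.2, v.1, v.2.1.1, v.2.2)
      invFun := fun w => (w.2.1, (w.2.2.1, w.1), w.2.2.2)
      map_add' := fun _ _ => rfl
      map_smul' := fun _ _ => rfl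
      left_inv := fun _ => rfl
      right_inv := fun _ => rfl }

set_option synthInstance.maxHeartbeats 200000 in
theorem nonempty_quotient_equiv_long (hm : 0 < m) (hp : Odd p) (hq : m = p * (n + 1)) :
    Nonempty ((S ⧸ Ideal.span {varX * varY * (varX ^ m - varY ^ m)}) ≃ₗ[R m p]
      (⨁ j : Finset.Icc 1 p, (Fin (2 * n) → X m p j)) ×
        (⨁ j : Finset.Icc 1 ((p - 1) / 2), (Fin 2 → N m p j)) ×
        (⨁ j : Finset.Icc 1 ((p - 1) / 2), (Fin (2 * n ^ 2) → K m p j)) ×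
        (Fin (2 * n.choose 2) → K m p 0) ×
        (R m p ⧸ Ideal.span {σ₁ m p}) ×
        (Fin n → R m p ⧸ Ideal.span {σ₂ m p ^ 2 - 4 * σ₁ m p ^ p}) ×
        (R m p ⧸ Ideal.span {Δ m p})) := by
  obtain ⟨e⟩ := nonempty_quotient_equiv_short hm hp hq
  obtain ⟨f⟩ := nonempty_split_K_zero m p n (2 * n.choose 2)
    (⨁ j : Finset.Icc 1 p, (Fin (2 * n) → X m p j))
    (⨁ j : Finset.Icc 1 ((p - 1) / 2), (Fin 2 → N m p j))
    (⨁ j : Finset.Icc 1 ((p - 1) / 2), (Fin (2 * n ^ 2) → K m p j))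
    (R m p ⧸ Ideal.span {σ₁ m p}) (R m p ⧸ Ideal.span {Δ m p})
  exact ⟨e ≪≫ₗ f⟩

/-- Scalars of A/I lift to A, so an A-linear isomorphism is automatically A/I-linear and transports
the annihilation by I. -/
theorem isoOverQuotient_of_linearEquiv {A M M' : Type*} [CommRing A] {I : Ideal A}
    [AddCommGroup M] [Module A M] [AddCommGroup M'] [Module A M']
    (h : Module.IsTorsionBySet A M I) (e : M ≃ₗ[A] M') : IsoOverQuotient I M M' := by
  have h' : Module.IsTorsionBySet A M' I := fun x a => e.symm.injective (by
    rw [map_smul, map_zero]; exact @h _ a)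
  refine ⟨h, h', ?_⟩
  let := h.module
  let := h'.module
  refine ⟨{ e.toAddEquiv with map_smul' := fun r x => ?_ }⟩
  obtain ⟨r, rfl⟩ := Ideal.Quotient.mk_surjective r
  exact e.map_smul r x

end Decomposition

/-! ### Reflecting lines, their stabilisers and the discriminant. -/

section Hyperplanes

variable {m p q : ℕ}

/-- The line `a v₀ + b v₁ = 0` in `ℂ²`. -/
def line (a b : ℂ) : Submodule ℂ (Fin 2 → ℂ) :=
  LinearMap.ker (a • LinearMap.proj (R := ℂ) (φ := fun _ : Fin 2 => ℂ) 0 + b • LinearMap.proj 1)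

theorem mem_line {a b : ℂ} {v : Fin 2 → ℂ} : v ∈ line a b ↔ a * v 0 + b * v 1 = 0 := by
  simp [line]

theorem finrank_line {a b : ℂ} (h : a ≠ 0 ∨ b ≠ 0) : Module.finrank ℂ (line a b) = 1 := by
  have hf : a • LinearMap.proj (R := ℂ) (φ := fun _ : Fin 2 => ℂ) 0 + b • LinearMap.proj 1 ≠ 0 := by
    intro h0
    have h1 := LinearMap.congr_fun h0 ![1, 0]
    have h2 := LinearMap.congr_fun h0 ![0, 1]
    simp at h1 h2
    exact h.elim (fun ha => ha h1) (fun hb => hb h2)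
  have := Module.Dual.finrank_ker_add_one_of_ne_zero hf
  rw [Module.finrank_fin_fun] at this
  exact Nat.succ.inj this

theorem eq_line {W : Submodule ℂ (Fin 2 → ℂ)} (hW : Module.finrank ℂ W = 1) {v : Fin 2 → ℂ}
    (hv : v ∈ W) (hv0 : v ≠ 0) {a b : ℂ} (h : a ≠ 0 ∨ b ≠ 0) (hab : v ∈ line a b) :
    W = line a b := by
  refine Submodule.eq_of_le_of_finrank_eq (fun w hw => ?_) (by rw [hW, finrank_line h])
  obtain ⟨c, hc⟩ := (finrank_eq_one_iff_of_nonzero' (⟨v, hv⟩ : W) (by simpa using hv0)).1 hW ⟨w, hw⟩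
  have : c • v = w := congrArg Subtype.val hc
  rw [← this]
  exact Submodule.smul_mem _ c hab

theorem associated_of_isDefiningForm {a b : ℂ} (h : a ≠ 0 ∨ b ≠ 0) {l : S}
    (hl : IsDefiningForm (line a b) l) : Associated l (C a * varX + C b * varY) := by
  obtain ⟨hl1, hl2⟩ := hl
  rw [← MvPolynomial.mem_homogeneousSubmodule, MvPolynomial.homogeneousSubmodule_one_eq_span_X,
    Submodule.mem_span_range_iff_exists_fun] at hl1
  obtain ⟨s, rfl⟩ := hl1
  have hev : ∀ v : Fin 2 → ℂ, a * v 0 + b * v 1 = 0 ↔ s 0 * v 0 + s 1 * v 1 = 0 := by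
    intro v
    rw [← mem_line, hl2 v]
    simp [Fin.sum_univ_two, MvPolynomial.smul_eval]
  -- The vector (-b, a) spans the line, so this is the proportionality of the coefficients s and (a,
  -- b).
  have h1 := (hev ![-b, a]).1 (by simp; ring)
  simp only [Matrix.cons_val_zero, Matrix.cons_val_one] at h1
  obtain ⟨c, hc, hc0, hc1⟩ : ∃ c, c ≠ 0 ∧ s 0 * c = a ∧ s 1 * c = b := by
    rcases h with ha | hb
    · have hs : s 0 ≠ 0 := fun hs => ha (by simpa using (hev ![1, 0]).2 (by simp [hs]))
      refine ⟨a / s 0, div_ne_zero ha hs, by field_simp, ?_⟩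
      field_simp
      linear_combination h1
    · have hs : s 1 ≠ 0 := fun hs => hb (by simpa using (hev ![0, 1]).2 (by simp [hs]))
      refine ⟨b / s 1, div_ne_zero hb hs, ?_, by field_simp⟩
      field_simp
      linear_combination -h1
  have hu : IsUnit (C c : S) := (IsUnit.mk0 c hc).map C
  refine ⟨hu.unit, ?_⟩
  rw [IsUnit.unit_spec, Fin.sum_univ_two, ← hc0, ← hc1, MvPolynomial.smul_eq_C_mul,
    MvPolynomial.smul_eq_C_mul, C.map_mul, C.map_mul]
  ring

/-- The `m`-th roots of unity. -/
noncomputable abbrev roots (m : ℕ) : Finset ℂ := Polynomial.nthRootsFinset m (1 : ℂ)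

theorem mem_roots {m : ℕ} (hm : 0 < m) {ζ : ℂ} : ζ ∈ roots m ↔ ζ ^ m = 1 :=
  Polynomial.mem_nthRootsFinset hm _

theorem card_roots {m : ℕ} (hm : 0 < m) : (roots m).card = m :=
  (Complex.isPrimitiveRoot_exp m hm.ne').card_nthRootsFinset

theorem diag_mulVec (a b : ℂ) (v : Fin 2 → ℂ) :
    (!![a, 0; 0, b] : Matrix (Fin 2) (Fin 2) ℂ).mulVec v = v ↔ a * v 0 = v 0 ∧ b * v 1 = v 1 := by
  rw [funext_iff, Fin.forall_fin_two]
  simp [Matrix.mulVec, dotProduct, Fin.sum_univ_two]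

theorem antidiag_mulVec (a b : ℂ) (v : Fin 2 → ℂ) :
    (!![0, b; a, 0] : Matrix (Fin 2) (Fin 2) ℂ).mulVec v = v ↔ b * v 1 = v 0 ∧ a * v 0 = v 1 := by
  rw [funext_iff, Fin.forall_fin_two]
  simp [Matrix.mulVec, dotProduct, Fin.sum_univ_two]

theorem GL_eq_one_iff {g : GL (Fin 2) ℂ} {a b : ℂ}
    (hg : (g : Matrix (Fin 2) (Fin 2) ℂ) = !![a, 0; 0, b]) : g = 1 ↔ a = 1 ∧ b = 1 := by
  rw [← Units.val_inj, hg, Units.val_one, Matrix.one_fin_two]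
  simp

/-- A diagonal element fixing a vector off both axes is the identity, while a vector fixed by an
antidiagonal element satisfies v₀ = b v₁ with b^m = 1. Conversely diag(η, 1) and diag(1, η), with η
a primitive q-th root of unity, are reflections; they are nontrivial because q > 1. -/
theorem hyperplanes_eq (hp : 0 < p) (hq : m = p * q) (hq1 : 1 < q) :
    hyperplanes (G m p 2) =
      insert (line 1 0) (insert (line 0 1) ((fun ζ => line 1 (-ζ)) '' (roots m : Set ℂ))) := by
  have hm : 0 < m := by rw [hq]; positivity
  have hdiv : m / p = q := by rw [hq, Nat.mul_div_cancel_left _ hp]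
  have hη := Complex.isPrimitiveRoot_exp q (by omega)
  have hηm : Complex.exp (2 * Real.pi * Complex.I / q) ^ m = 1 := by
    rw [hq, pow_mul', hη.pow_eq_one, one_pow]
  ext W
  simp only [Set.mem_insert_iff, Set.mem_image, Finset.mem_coe, mem_roots hm]
  constructor
  · rintro ⟨hW, g, hg, hg1, hfix⟩
    replace hW : Module.finrank ℂ W = 1 := Nat.succ.inj hW
    obtain ⟨⟨v, hvW⟩, hv0, -⟩ := finrank_eq_one_iff'.1 hW
    replace hv0 : v ≠ 0 := by simpa using hv0
    have hgv := hfix v hvW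
    obtain ⟨a, b, ha, hb, -, hgm | hgm⟩ := mem_G_two_iff.1 hg
    · rw [hgm, diag_mulVec] at hgv
      by_cases h0 : v 0 = 0
      · exact Or.inl (eq_line hW hvW hv0 (by simp) (by simp [mem_line, h0]))
      · by_cases h1 : v 1 = 0
        · exact Or.inr (Or.inl (eq_line hW hvW hv0 (by simp) (by simp [mem_line, h1])))
        · exact absurd ((GL_eq_one_iff hgm).2
            ⟨(mul_eq_right₀ h0).1 hgv.1, (mul_eq_right₀ h1).1 hgv.2⟩) hg1
    · rw [hgm, antidiag_mulVec] at hgv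
      refine Or.inr (Or.inr ⟨b, hb, (eq_line hW hvW hv0 (by simp) ?_).symm⟩)
      rw [mem_line, ← hgv.1]
      ring
  · rintro (rfl | rfl | ⟨ζ, hζ, rfl⟩)
    · refine ⟨by rw [finrank_line (by simp)], ?_⟩
      obtain ⟨g, hg, hgm⟩ := exists_diag_mem_G (p := p) hm hηm (one_pow m)
        (by rw [mul_one, hdiv, hη.pow_eq_one])
      refine ⟨g, hg, fun h => hη.ne_one hq1 ((GL_eq_one_iff hgm).1 h).1, fun v hv => ?_⟩
      rw [mem_line] at hv
      rw [hgm, diag_mulVec, show v 0 = 0 by simpa using hv]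
      simp
    · refine ⟨by rw [finrank_line (by simp)], ?_⟩
      obtain ⟨g, hg, hgm⟩ := exists_diag_mem_G (p := p) hm (one_pow m) hηm
        (by rw [one_mul, hdiv, hη.pow_eq_one])
      refine ⟨g, hg, fun h => hη.ne_one hq1 ((GL_eq_one_iff hgm).1 h).2, fun v hv => ?_⟩
      rw [mem_line] at hv
      rw [hgm, diag_mulVec, show v 1 = 0 by simpa using hv]
      simp
    · refine ⟨by rw [finrank_line (by simp)], ?_⟩
      have hζ0 : ζ ≠ 0 := by rintro rfl; simp [hm.ne'] at hζ
      obtain ⟨g, hg, hgm⟩ := exists_antidiag_mem_G (p := p) hm (a := ζ⁻¹) (b := ζ)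
        (by rw [inv_pow, hζ, inv_one]) hζ (by rw [inv_mul_cancel₀ hζ0, one_pow])
      refine ⟨g, hg, ?_, fun v hv => ?_⟩
      · rintro rfl
        have := congrFun (congrFun hgm 0) 0
        simp at this
      · rw [mem_line] at hv
        have h0 : v 0 = ζ * v 1 := by linear_combination hv
        rw [hgm, antidiag_mulVec, h0]
        exact ⟨rfl, by rw [inv_mul_cancel_left₀ hζ0]⟩

/-- Serves to count the stabilisers of the two axes, which are parametrised by the q-th roots of
unity. -/
theorem card_eq_of_parametrization {T : GL (Fin 2) ℂ → Prop} (hq0 : 0 < q)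
    (D : ℂ → Matrix (Fin 2) (Fin 2) ℂ) (hD : Function.Injective D)
    (hT : ∀ g, T g → ∃ a, a ^ q = 1 ∧ (g : Matrix (Fin 2) (Fin 2) ℂ) = D a)
    (hT' : ∀ a, a ^ q = 1 → ∃ g, T g ∧ (g : Matrix (Fin 2) (Fin 2) ℂ) = D a) :
    Nat.card {g // T g} = q := by
  choose f hf hfD using fun a : roots q => hT' a ((mem_roots hq0).1 a.2)
  have hbij : Function.Bijective fun a : roots q => (⟨f a, hf a⟩ : {g // T g}) := by
    constructor
    · intro a b hab
      have h : f a = f b := congrArg Subtype.val hab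
      exact Subtype.ext (hD (by rw [← hfD, ← hfD, h]))
    · rintro ⟨g, hg⟩
      obtain ⟨a, ha, hga⟩ := hT g hg
      refine ⟨⟨a, (mem_roots hq0).2 ha⟩, Subtype.ext (Units.ext ?_)⟩
      rw [hfD, hga]
  rw [← Nat.card_eq_of_bijective _ hbij, Nat.card_eq_fintype_card, Fintype.card_coe,
    card_roots hq0]

theorem fixerOrder_line_one_zero (hp : 0 < p) (hq : m = p * q) (hq0 : 0 < q) :
    fixerOrder (G m p 2) (line 1 0) = q := by
  have hm : 0 < m := by rw [hq]; positivity
  have hdiv : m / p = q := by rw [hq, Nat.mul_div_cancel_left _ hp]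
  refine card_eq_of_parametrization hq0 (fun a => !![a, 0; 0, 1])
    (fun a b hab => by simpa using hab) ?_ ?_
  · rintro g ⟨hg, hfix⟩
    have hgv := hfix ![0, 1] (by simp [mem_line])
    obtain ⟨a, b, -, -, hab, hgm | hgm⟩ := mem_G_two_iff.1 hg
    · rw [hgm, diag_mulVec] at hgv
      have hb1 : b = 1 := by simpa using hgv.2
      subst hb1
      exact ⟨a, by rwa [mul_one, hdiv] at hab, hgm⟩
    · rw [hgm, antidiag_mulVec] at hgv
      simp at hgv
  · intro a ha
    obtain ⟨g, hg, hgm⟩ := exists_diag_mem_G (p := p) hm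
      (by rw [hq, pow_mul', ha, one_pow] : a ^ m = 1) (one_pow m) (by rw [mul_one, hdiv, ha])
    refine ⟨g, ⟨hg, fun v hv => ?_⟩, hgm⟩
    rw [mem_line] at hv
    rw [hgm, diag_mulVec, show v 0 = 0 by simpa using hv]
    simp

theorem fixerOrder_line_zero_one (hp : 0 < p) (hq : m = p * q) (hq0 : 0 < q) :
    fixerOrder (G m p 2) (line 0 1) = q := by
  have hm : 0 < m := by rw [hq]; positivity
  have hdiv : m / p = q := by rw [hq, Nat.mul_div_cancel_left _ hp]
  refine card_eq_of_parametrization hq0 (fun b => !![1, 0; 0, b])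
    (fun a b hab => by simpa using hab) ?_ ?_
  · rintro g ⟨hg, hfix⟩
    have hgv := hfix ![1, 0] (by simp [mem_line])
    obtain ⟨a, b, -, -, hab, hgm | hgm⟩ := mem_G_two_iff.1 hg
    · rw [hgm, diag_mulVec] at hgv
      have ha1 : a = 1 := by simpa using hgv.1
      subst ha1
      exact ⟨b, by rwa [one_mul, hdiv] at hab, hgm⟩
    · rw [hgm, antidiag_mulVec] at hgv
      simp at hgv
  · intro b hb
    obtain ⟨g, hg, hgm⟩ := exists_diag_mem_G (p := p) hm (one_pow m)
      (by rw [hq, pow_mul', hb, one_pow] : b ^ m = 1) (by rw [one_mul, hdiv, hb])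
    refine ⟨g, ⟨hg, fun v hv => ?_⟩, hgm⟩
    rw [mem_line] at hv
    rw [hgm, diag_mulVec, show v 1 = 0 by simpa using hv]
    simp

theorem fixerOrder_line_root (p : ℕ) (hm : 0 < m) {ζ : ℂ} (hζ : ζ ^ m = 1) :
    fixerOrder (G m p 2) (line 1 (-ζ)) = 2 := by
  have hζ0 : ζ ≠ 0 := by rintro rfl; simp [hm.ne'] at hζ
  obtain ⟨s, hs, hsm⟩ := exists_antidiag_mem_G (p := p) hm (a := ζ⁻¹) (b := ζ)
    (by rw [inv_pow, hζ, inv_one]) hζ (by rw [inv_mul_cancel₀ hζ0, one_pow])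
  have hs1 : 1 ≠ s := by
    rintro rfl
    have := congrFun (congrFun hsm 0) 0
    simp at this
  have hsfix : ∀ v ∈ line 1 (-ζ), (s : Matrix (Fin 2) (Fin 2) ℂ).mulVec v = v := by
    intro v hv
    rw [mem_line] at hv
    have h0 : v 0 = ζ * v 1 := by linear_combination hv
    rw [hsm, antidiag_mulVec, h0]
    exact ⟨rfl, by rw [inv_mul_cancel_left₀ hζ0]⟩
  rw [fixerOrder, Nat.card_eq_two_iff]
  refine ⟨⟨1, one_mem _, by simp⟩, ⟨s, hs, hsfix⟩, fun h => hs1 (congrArg Subtype.val h), ?_⟩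
  rw [Set.eq_univ_iff_forall]
  rintro ⟨g, hg, hfix⟩
  have hgv := hfix ![ζ, 1] (by simp [mem_line])
  obtain ⟨a, b, -, -, -, hgm | hgm⟩ := mem_G_two_iff.1 hg
  · rw [hgm, diag_mulVec] at hgv
    have ha : a = 1 := by simpa [hζ0] using hgv.1
    have hb : b = 1 := by simpa using hgv.2
    exact Or.inl (Subtype.ext ((GL_eq_one_iff hgm).2 ⟨ha, hb⟩))
  · rw [hgm, antidiag_mulVec] at hgv
    have hb : b = ζ := by simpa using hgv.1
    have ha : a = ζ⁻¹ := eq_inv_of_mul_eq_one_left (by simpa using hgv.2)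
    refine Or.inr (Subtype.ext (Units.ext ?_))
    rw [hgm, hsm, ha, hb]

/-- Stated for a general function F so that it covers both z, with F = α, and the discriminant, with
F W = α_W^{e_W}. -/
theorem associated_finprod_hyperplanes (hp : 0 < p) (hq : m = p * q) (hq1 : 1 < q)
    (F : Submodule ℂ (Fin 2 → ℂ) → S) {f₀ f₁ : S} {f : ℂ → S} (h₀ : Associated (F (line 1 0)) f₀)
    (h₁ : Associated (F (line 0 1)) f₁)
    (h : ∀ ζ ∈ roots m, Associated (F (line 1 (-ζ))) (f ζ)) :
    Associated (∏ᶠ W ∈ hyperplanes (G m p 2), F W) (f₀ * (f₁ * ∏ ζ ∈ roots m, f ζ)) := by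
  have hfin : ((fun ζ => line 1 (-ζ)) '' (roots m : Set ℂ)).Finite :=
    (Finset.finite_toSet _).image _
  have hy : line 0 1 ∉ (fun ζ => line 1 (-ζ)) '' (roots m : Set ℂ) := by
    rintro ⟨ζ, -, hζ⟩
    have : (![1, 0] : Fin 2 → ℂ) ∈ line 1 (-ζ) := by
      replace hζ : line 1 (-ζ) = line 0 1 := hζ
      rw [hζ]; simp [mem_line]
    simp [mem_line] at this
  have hx : line 1 0 ∉ insert (line 0 1) ((fun ζ => line 1 (-ζ)) '' (roots m : Set ℂ)) := by
    have h01 : (![0, 1] : Fin 2 → ℂ) ∈ line 1 0 := by simp [mem_line]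
    have hm : 0 < m := by rw [hq]; positivity
    rintro (hxy | ⟨ζ, hζ, hxζ⟩)
    · rw [hxy] at h01
      simp [mem_line] at h01
    · rw [← hxζ] at h01
      have hζ0 : ζ = 0 := by simpa [mem_line] using h01
      have := (mem_roots hm).1 hζ
      simp [hζ0, hm.ne'] at this
  have hinj : Set.InjOn (fun ζ => line 1 (-ζ)) (roots m : Set ℂ) := by
    intro ζ _ ζ' _ hζζ
    have h1 : (![ζ, 1] : Fin 2 → ℂ) ∈ line 1 (-ζ) := by simp [mem_line]
    replace hζζ : line 1 (-ζ) = line 1 (-ζ') := hζζ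
    rw [hζζ, mem_line] at h1
    simpa [add_neg_eq_zero] using h1
  rw [hyperplanes_eq hp hq hq1, finprod_mem_insert _ hx (hfin.insert _),
    finprod_mem_insert _ hy hfin, finprod_mem_image hinj, finprod_mem_coe_finset]
  exact h₀.mul_mul (h₁.mul_mul (Associated.prod _ _ _ h))

theorem prod_roots_sub (hm : 0 < m) :
    ∏ ζ ∈ roots m, (C 1 * varX + C (-ζ) * varY) = varX ^ m - varY ^ m := by
  have hω : IsPrimitiveRoot (C (Complex.exp (2 * Real.pi * Complex.I / m)) : S) m :=
    (Complex.isPrimitiveRoot_exp m hm.ne').map_of_injective (MvPolynomial.C_injective _ _)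
  rw [hω.pow_sub_pow_eq_prod_sub_mul _ _ hm]
  -- The factorisation runs over the roots of unity in S; these are the constants, since both sets
  -- have m elements.
  refine Finset.prod_nbij C (fun ζ hζ => ?_) (MvPolynomial.C_injective _ _).injOn ?_
    (fun ζ _ => by simp [sub_eq_add_neg])
  · exact Polynomial.map_mem_nthRootsFinset_one hζ _
  · refine Finset.surjOn_of_injOn_of_card_le _ (fun ζ hζ => ?_)
      (MvPolynomial.C_injective _ _).injOn ?_
    · exact Polynomial.map_mem_nthRootsFinset_one hζ _
    · rw [hω.card_nthRootsFinset, card_roots hm]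

theorem associated_arrangementPoly (hp : 0 < p) (hq : m = p * q) (hq1 : 1 < q)
    {α : Submodule ℂ (Fin 2 → ℂ) → S}
    (hα : ∀ W ∈ hyperplanes (G m p 2), IsDefiningForm W (α W)) :
    Associated (arrangementPoly (G m p 2) α) (varX * varY * (varX ^ m - varY ^ m)) := by
  have hm : 0 < m := by rw [hq]; positivity
  rw [hyperplanes_eq hp hq hq1] at hα
  have h := associated_finprod_hyperplanes hp hq hq1 α
    (associated_of_isDefiningForm (by simp) (hα _ (by simp)))
    (associated_of_isDefiningForm (by simp) (hα _ (by simp)))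
    (fun ζ hζ => associated_of_isDefiningForm (by simp) (hα _ (by
      exact Or.inr (Or.inr ⟨ζ, hζ, rfl⟩))))
  rw [prod_roots_sub hm] at h
  simpa [arrangementPoly, mul_assoc] using h

theorem associated_discriminantPoly (hp : 0 < p) (hq : m = p * q) (hq1 : 1 < q)
    {α : Submodule ℂ (Fin 2 → ℂ) → S}
    (hα : ∀ W ∈ hyperplanes (G m p 2), IsDefiningForm W (α W)) :
    Associated (discriminantPoly (G m p 2) α) ((varX * varY) ^ q * (varX ^ m - varY ^ m) ^ 2) := by
  have hm : 0 < m := by rw [hq]; positivity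
  rw [hyperplanes_eq hp hq hq1] at hα
  have h := associated_finprod_hyperplanes hp hq hq1
    (fun W => α W ^ fixerOrder (G m p 2) W) (f₀ := (C 1 * varX + C 0 * varY) ^ q)
    (f₁ := (C 0 * varX + C 1 * varY) ^ q) (f := fun ζ => (C 1 * varX + C (-ζ) * varY) ^ 2)
    (by
      rw [fixerOrder_line_one_zero hp hq (by omega)]
      exact (associated_of_isDefiningForm (by simp) (hα _ (by simp))).pow_pow)
    (by
      rw [fixerOrder_line_zero_one hp hq (by omega)]
      exact (associated_of_isDefiningForm (by simp) (hα _ (by simp))).pow_pow)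
    (fun ζ hζ => by
      rw [fixerOrder_line_root p hm ((mem_roots hm).1 hζ)]
      exact (associated_of_isDefiningForm (by simp)
        (hα _ (Or.inr (Or.inr ⟨ζ, hζ, rfl⟩)))).pow_pow)
  rw [Finset.prod_pow, prod_roots_sub hm] at h
  simpa [discriminantPoly, mul_pow, mul_assoc] using h

theorem algebraMap_Δ (hp : 0 < p) (hq : m = p * q) :
    algebraMap (R m p) S (Δ m p) = (varX * varY) ^ q * (varX ^ m - varY ^ m) ^ 2 := by
  have h4 : algebraMap (R m p) S 4 = 4 := map_ofNat _ 4
  rw [Δ, map_mul, map_sub, map_pow, map_mul, map_pow, h4, algebraMap_σ₁ hp hq, algebraMap_σ₂,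
    ← pow_mul, mul_comm q p, ← hq]
  ring

theorem isTorsionBySet_quotient (hp : 0 < p) (hq : m = p * q) (hq0 : 0 < q) :
    Module.IsTorsionBySet (R m p) (S ⧸ Ideal.span {varX * varY * (varX ^ m - varY ^ m)})
      (Ideal.span {Δ m p} : Ideal (R m p)) := by
  rintro x ⟨a, ha⟩
  obtain ⟨b, rfl⟩ := Ideal.mem_span_singleton'.1 ha
  obtain ⟨f, rfl⟩ := Ideal.Quotient.mk_surjective x
  change Ideal.Quotient.mk _ ((b * Δ m p) • f) = 0
  rw [Ideal.Quotient.eq_zero_iff_mem, Ideal.mem_span_singleton, Algebra.smul_def, map_mul,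
    algebraMap_Δ hp hq]
  refine Dvd.dvd.mul_right (Dvd.dvd.mul_left (mul_dvd_mul ?_ ?_) _) f
  · exact dvd_pow_self _ hq0.ne'
  · exact dvd_pow_self _ two_ne_zero

end Hyperplanes

end ReflGroup

open ReflGroup in
theorem mainTheorem5 (m p q : ℕ) (hm : 0 < m) (hq : m = p * q) (hp : Odd p) (hmp : m ≠ p)
    (α : Submodule ℂ (Fin 2 → ℂ) → S)
    (hα : ∀ W ∈ hyperplanes (G m p 2), IsDefiningForm W (α W)) :
    Associated (discriminantPoly (G m p 2) α) (algebraMap (R m p) S (Δ m p)) ∧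
    IsoOverQuotient (Ideal.span {Δ m p})
      (S ⧸ Ideal.span {arrangementPoly (G m p 2) α})
      ((⨁ j : Finset.Icc 1 p, (Fin (2 * (q - 1)) → X m p j)) ×
        (⨁ j : Finset.Icc 1 ((p - 1) / 2), (Fin 2 → N m p j)) ×
        (⨁ j : Finset.Icc 1 ((p - 1) / 2), (Fin (2 * (q - 1) ^ 2) → K m p j)) ×
        (Fin (2 * (q - 1).choose 2) → K m p 0) ×
        (R m p ⧸ Ideal.span {σ₁ m p}) ×
        (Fin (q - 1) → R m p ⧸ Ideal.span {σ₂ m p ^ 2 - 4 * σ₁ m p ^ p}) ×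
        (R m p ⧸ Ideal.span {Δ m p})) ∧
    IsoOverQuotient (Ideal.span {Δ m p})
      (S ⧸ Ideal.span {arrangementPoly (G m p 2) α})
      ((⨁ j : Finset.Icc 1 p, (Fin (2 * (q - 1)) → X m p j)) ×
        (⨁ j : Finset.Icc 1 ((p - 1) / 2), (Fin 2 → N m p j)) ×
        (⨁ j : Finset.Icc 1 ((p - 1) / 2), (Fin (2 * (q - 1) ^ 2) → K m p j)) ×
        (R m p ⧸ Ideal.span {σ₁ m p}) ×
        (Fin (q - 1 + 2 * (q - 1).choose 2) →
          R m p ⧸ Ideal.span {σ₂ m p ^ 2 - 4 * σ₁ m p ^ p}) ×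
        (R m p ⧸ Ideal.span {Δ m p})) := by
  have hp0 : 0 < p := hp.pos
  obtain ⟨n, rfl⟩ : ∃ n, q = n + 1 :=
    Nat.exists_eq_succ_of_ne_zero (by rintro rfl; simp [hq] at hm)
  -- m ≠ p means q > 1, which makes the coordinate axes reflecting lines.
  have hn : 0 < n := Nat.pos_of_ne_zero (by rintro rfl; exact hmp (by simpa using hq))
  have hz := Ideal.span_singleton_eq_span_singleton.2
    (associated_arrangementPoly hp0 hq (by omega) hα)
  have htor := isTorsionBySet_quotient hp0 hq n.succ_pos
  obtain ⟨e⟩ := nonempty_quotient_equiv_short hm hp hq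
  obtain ⟨f⟩ := nonempty_quotient_equiv_long hm hp hq
  rw [hz, algebraMap_Δ hp0 hq, Nat.add_sub_cancel]
  refine ⟨associated_discriminantPoly hp0 hq (by omega) hα,
    isoOverQuotient_of_linearEquiv htor f, isoOverQuotient_of_linearEquiv htor e⟩
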